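/- All Coxeter systems $(W,S)$ have $S$ finite. For $J\subseteq S$ let $W_J=\langle J\rangle$; then $(W_J,J)$ is a Coxeter system, and an adjective applied to $J$ or $W_J$ refers to it. A Coxeter system is *spherical* if its group is finite; it is *irreducible* if $S$ is not a disjoint union of two non-empty sets $S_1,S_2$ with $m_{st}=2$ for all $s\in S_1$, $t\in S_2$; it is *irreducible affine* if it is irreducible, non-spherical, and the bilinear form on $\mathbb R[S]$ with $\langle s,t\rangle=-\cos(\pi/m_{st})$ ($=-1$ if $m_{st}=\infty$) is positive semidefinite. For $s\in S$ let $s^\perp=\{t\in S: m_{st}=2\}$. Let $\mathbb T$ be the smallest class of Coxeter systems such that: 1. $\mathbb T$ contains all irreducible affine systems $(W,S)$ with $|S|\ge 3$, and all systems $(W,S_1\cup S_2)$ with $W_{S_1},W_{S_2}$ irreducible non-spherical and $[W_{S_1},W_{S_2}]=1$; 2. if $(W,S\cup\{s\})$, $s\notin S$, is a Coxeter system such that $s^\perp$ is non-spherical and $(W_S,S)\in\mathbb T$, then $(W,S\cup\{s\})\in\mathbb T$; 3. if $S=S_1\cup S_2$ with $(W_{S_1},S_1),(W_{S_2},S_2)\in\mathbb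 T$ and $W_{S_1\cap S_2}$ non-spherical, then $(W,S)\in\mathbb T$. Let $\mathcal T$ be the smallest class of finite simplicial graphs (closed under isomorphism) such that: 1. the $4$-cycle $K_{2,2}$ is in $\mathcal T$; 2. if $\Gamma\in\mathcal T$ and $\Lambda$ is an induced subgraph of $\Gamma$ that is not a clique, then the graph obtained from $\Gamma$ by adding one new vertex, joined exactly to the vertices of $\Lambda$, is in $\mathcal T$; 3. if $\Gamma_1,\Gamma_2\in\mathcal T$ contain isomorphic induced subgraphs $\Gamma$ that are not cliques, then every graph obtained by gluing $\Gamma_1$ and $\Gamma_2$ along $\Gamma$ and then adding any collection of edges between vertices of $\Gamma_1\setminus\Gamma$ and vertices of $\Gamma_2\setminus\Gamma$ is in $\mathcal T$. For a graph $\Gamma$ let $W_\Gamma$ be the right-angled Coxeter group generated by the vertices $v$ of $\Gamma$, with relations $v^2=1$, and $(vw)^2=1$ for each edge $vw$. A finitely generated group $G$ is *strongly algebraically thick of order $0$* if it is wide, i.e. no asymptotic cone of $G$ (for any non-principal ultrafilter, any scaling sequence tending to infinity and any base points) has a cut-point. For $n\ge1$, $G$ is *strongly algebraically thick of order at most $n$*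 if, for some word metric on $G$, there are a finite collection $\mathcal H$ of subgroups and a constant $C$ such that: each $H\in\mathcal H$ is strongly algebraically thick of order at most $n-1$; $\langle\bigcup_{H\in\mathcal H}H\rangle$ has finite index in $G$; any two $H,H'\in\mathcal H$ are joined by a sequence $H=H_1,\dots,H_k=H'$ in $\mathcal H$ such that, for all $i<k$, $H_i\cap H_{i+1}$ is infinite and its $C$-neighbourhood is path-connected (in the Cayley graph); and for each $H\in\mathcal H$ any two points of $H$ are joined by a $(C,C)$-quasigeodesic in the $C$-neighbourhood of $H$. $G$ is *strongly algebraically thick* if it is so of order at most $n$ for some $n\ge 0$. **Theorem.** (a) If the Coxeter system $(W,S)$ belongs to $\mathbb T$, then $W$ is strongly algebraically thick. (b) For every $\Gamma\in\mathcal T$, the group $W_\Gamma$ is strongly algebraically thick. -/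

import Mathlib

universe u v w

open Filter Topology
open scoped NNReal

namespace ThickCoxeter

noncomputable section

/-! ### Word metrics -/

/-- A finite generating set of a group. -/
structure GenSet (G : Type u) [Group G] where
  carrier : Finset G
  closure_eq : Subgroup.closure (carrier : Set G) = ⊤

namespace GenSet

variable {G : Type u} [Group G] (S : GenSet G)

/-- The Cayley graph of `G` with respect to `S`: edges join `g` to `g * s`, for `s ∈ S`. -/
def cayley : SimpleGraph G := SimpleGraph.mulCayley (S.carrier : Set G)

theorem cayley_reachable_mul (a g : G) : S.cayley.Reachable a (a * g) := by
  have hg : g ∈ Subgroup.closure (S.carrier : Set G) := by rw [S.closure_eq]; trivial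
  induction hg using Subgroup.closure_induction generalizing a with
  | mem x hx =>
    by_cases h : a = a * x
    · rw [← h]
    · apply SimpleGraph.Adj.reachable
      rw [cayley, SimpleGraph.mulCayley_adj']
      exact ⟨h, x, hx, Or.inl rfl⟩
  | one => simp
  | mul x y _ _ hx hy => rw [← mul_assoc]; exact (hx a).trans (hy (a * x))
  | inv x _ hx => simpa using (hx (a * x⁻¹)).symm

theorem cayley_connected : S.cayley.Connected where
  preconnected a b := by simpa using S.cayley_reachable_mul a (a⁻¹ * b)
  nonempty := ⟨1⟩

/-- The underlying set of `G`, to be equipped with the word metric of `S`. -/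
def Point (_S : GenSet G) : Type u := G

/-- The word metric: distance in the Cayley graph. -/
instance instMetricSpacePoint : MetricSpace S.Point where
  dist g h := (S.cayley.dist (V := G) g h : ℝ)
  dist_self g := by exact_mod_cast SimpleGraph.dist_self (G := S.cayley) (v := g)
  dist_comm g h := by
    exact_mod_cast SimpleGraph.dist_comm (G := S.cayley) (u := g) (v := h)
  dist_triangle g h k := by exact_mod_cast S.cayley_connected.dist_triangle
  eq_of_dist_eq_zero {g h} hgh := by
    have : S.cayley.dist (V := G) g h = 0 := by exact_mod_cast hgh
    exact S.cayley_connected.dist_eq_zero_iff.1 this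

/-- The distance of two group elements in the word metric of `S`. -/
def wordDist (g h : G) : ℝ := dist (α := S.Point) g h

/-- The `C`-neighbourhood of a subset of `G`, in the word metric of `S`. -/
def nhd (C : ℝ) (A : Set G) : Set G := {g | ∃ a ∈ A, S.wordDist g a ≤ C}

/-- A set of vertices spans a path-connected subgraph of the Cayley graph. -/
def PathConn (A : Set G) : Prop := (S.cayley.induce A).Connected

/-- `q`, restricted to `[0, L]`, is a `(C, C)`-quasigeodesic from `x` to `y` for the word metric of
`S`. -/
def IsQuasigeodesic (C L : ℝ) (q : ℝ → G) (x y : G) : Prop :=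
  q 0 = x ∧ q L = y ∧ ∀ s ∈ Set.Icc 0 L, ∀ t ∈ Set.Icc 0 L,
    |s - t| / C - C ≤ S.wordDist (q s) (q t) ∧ S.wordDist (q s) (q t) ≤ C * |s - t| + C

end GenSet

/-! ### Asymptotic cones -/

section Cone

variable {X : Type u} [PseudoMetricSpace X] (ω : Ultrafilter ℕ) (d : ℕ → ℝ≥0) (e : ℕ → X)

/-- The sequences in `X` that stay at distance `O(d n)` from the base points `e n`, `ω`-almost
surely. -/
def ConeSeq : Type u := {x : ℕ → X // ∃ K : ℝ, ∀ᶠ n in (ω : Filter ℕ), dist (x n) (e n) / d n ≤ K}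

variable {ω d e}

/-- The distance of two such sequences: the `ω`-limit of `dist (x n) (y n) / d n`. -/
def coneDist (x y : ConeSeq ω d e) : ℝ :=
  limUnder (ω : Filter ℕ) fun n => dist (x.1 n) (y.1 n) / (d n : ℝ)

theorem tendsto_coneDist (x y : ConeSeq ω d e) :
    Tendsto (fun n => dist (x.1 n) (y.1 n) / (d n : ℝ)) ω (𝓝 (coneDist x y)) := by
  obtain ⟨K, hK⟩ := x.2
  obtain ⟨L, hL⟩ := y.2
  have h : ∀ᶠ n in (ω : Filter ℕ), dist (x.1 n) (y.1 n) / (d n : ℝ) ∈ Set.Icc 0 (K + L) := by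
    filter_upwards [hK, hL] with n h1 h2
    refine ⟨by positivity, ?_⟩
    calc dist (x.1 n) (y.1 n) / (d n : ℝ)
        ≤ (dist (x.1 n) (e n) + dist (y.1 n) (e n)) / d n := by
          gcongr; exact dist_triangle_right _ _ _
      _ ≤ K + L := by rw [add_div]; exact add_le_add h1 h2
  obtain ⟨l, -, hl⟩ := (isCompact_Icc (a := (0 : ℝ)) (b := K + L)).ultrafilter_le_nhds
    (ω.map fun n => dist (x.1 n) (y.1 n) / (d n : ℝ)) (le_principal_iff.2 h)
  exact tendsto_nhds_limUnder ⟨l, hl⟩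

instance : PseudoMetricSpace (ConeSeq ω d e) where
  dist := coneDist
  dist_self x := tendsto_nhds_unique (tendsto_coneDist x x) (by simp)
  dist_comm x y := by simp only [coneDist, dist_comm]
  dist_triangle x y z := by
    refine le_of_tendsto_of_tendsto' (tendsto_coneDist x z)
      ((tendsto_coneDist x y).add (tendsto_coneDist y z)) fun n => ?_
    rw [← add_div]
    gcongr
    exact dist_triangle _ _ _

variable (ω d e)

/-- The asymptotic cone of `X` for the ultrafilter `ω`, the scaling sequence `d` and the base points
`e`: the metric space of the sequences above, where those at distance `0` are identified. -/
abbrev AsymptoticCone : Type u := SeparationQuotient (ConeSeq ω d e)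

end Cone

/-- `p` is a cut-point of `Y`: its complement is disconnected. -/
def IsCutPoint {Y : Type u} [TopologicalSpace Y] (p : Y) : Prop :=
  ¬ IsPreconnected ({p}ᶜ : Set Y)

/-- A finitely generated group is wide if no asymptotic cone of it has a cut-point. The cones are
those of a word metric; another word metric gives bi-Lipschitz equivalent cones. -/
def IsWide (G : Type u) [Group G] : Prop :=
  ∃ S : GenSet G, ∀ (ω : Ultrafilter ℕ) (d : ℕ → ℝ≥0) (e : ℕ → S.Point),
    (ω : Filter ℕ) ≤ cofinite → Tendsto d ω atTop →
      ∀ p : AsymptoticCone ω d e, ¬ IsCutPoint p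

/-! ### Strong algebraic thickness -/

/-- `K` and `L` are two members of `ℋ`, their intersection is infinite and the `C`-neighbourhood of
the intersection is path-connected. -/
def ThicklyMeet {G : Type u} [Group G] (S : GenSet G) (C : ℝ) (ℋ : Set (Subgroup G))
    (K L : Subgroup G) : Prop :=
  K ∈ ℋ ∧ L ∈ ℋ ∧ Infinite ↥(K ⊓ L) ∧ S.PathConn (S.nhd C ((K ⊓ L : Subgroup G) : Set G))

/-- `G` is strongly algebraically thick of order at most `n`. The constant is taken to be at least
`1`, as is usual for quasigeodesics; the conditions persist when it is enlarged. -/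
def ThickOfOrderAtMost : ℕ → (G : Type u) → [Group G] → Prop
  | 0, G, _ => IsWide G
  | n + 1, G, _ => ∃ (S : GenSet G) (ℋ : Set (Subgroup G)) (C : ℝ), ℋ.Finite ∧ 1 ≤ C ∧
      (∀ H ∈ ℋ, ThickOfOrderAtMost n ↥H) ∧
      (Subgroup.closure (⋃ H ∈ ℋ, (H : Set G))).FiniteIndex ∧
      (∀ H ∈ ℋ, ∀ H' ∈ ℋ, Relation.ReflTransGen (ThicklyMeet S C ℋ) H H') ∧
      (∀ H ∈ ℋ, ∀ x ∈ H, ∀ y ∈ H, ∃ (L : ℝ) (q : ℝ → G), 0 ≤ L ∧ S.IsQuasigeodesic C L q x y ∧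
        ∀ t ∈ Set.Icc 0 L, q t ∈ S.nhd C (H : Set G))

/-- `G` is strongly algebraically thick (of some order). -/
def StronglyAlgThick (G : Type u) [Group G] : Prop := ∃ n, ThickOfOrderAtMost n G

/-! ### Coxeter systems -/

section Coxeter

variable {B : Type u} (M : CoxeterMatrix B)

/-- The Coxeter matrix of the parabolic subsystem `(W_J, J)`. -/
def restrict (J : Set B) : CoxeterMatrix J where
  M i j := M i j
  isSymm := by ext i j; exact M.symmetric j i
  diagonal i := M.diagonal i
  off_diagonal i j h := M.off_diagonal i j fun h' => h (Subtype.ext h')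

/-- The parabolic subgroup `W_J`. -/
def parabolic (J : Set B) : Subgroup M.Group := Subgroup.closure (M.simple '' J)

/-- The Coxeter system is spherical: its Coxeter group is finite. -/
def IsSpherical : Prop := Finite M.Group

/-- The set of generators is not the disjoint union of two non-empty sets `J`, `K` with `m = 2`
between `J` and `K`. -/
def IsIrreducible : Prop :=
  ¬ ∃ J K : Set B, J.Nonempty ∧ K.Nonempty ∧ Disjoint J K ∧ J ∪ K = Set.univ ∧
    ∀ i ∈ J, ∀ j ∈ K, M i j = 2

/-- The matrix of the bilinear form of the Coxeter system (`M i j = 0` encodes that `i`, `j` satisfy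
no relation). -/
def formMatrix : Matrix B B ℝ :=
  fun i j => if M i j = 0 then -1 else -Real.cos (Real.pi / M i j)

/-- Irreducible affine: irreducible, non-spherical, and with positive semidefinite form. -/
def IsIrreducibleAffine : Prop :=
  IsIrreducible M ∧ ¬ IsSpherical M ∧ (formMatrix M).PosSemidef

/-- `s^⊥`, the set of the generators other than `s` that commute with `s`. -/
def perp (s : B) : Set B := {t | M s t = 2}

end Coxeter

/-- The class `𝕋` of Coxeter systems. A Coxeter system is given by its Coxeter matrix, the
subsystem `(W_J, J)` by the restricted matrix. -/
inductive ClassT : ∀ {B : Type u}, CoxeterMatrix B → Prop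
  | affine {B : Type u} (M : CoxeterMatrix B) :
      IsIrreducibleAffine M → 3 ≤ Nat.card B → ClassT M
  | product {B : Type u} (M : CoxeterMatrix B) (S₁ S₂ : Set B) :
      S₁ ∪ S₂ = Set.univ →
      IsIrreducible (restrict M S₁) → ¬ IsSpherical (restrict M S₁) →
      IsIrreducible (restrict M S₂) → ¬ IsSpherical (restrict M S₂) →
      ⁅parabolic M S₁, parabolic M S₂⁆ = ⊥ → ClassT M
  | adjoin {B : Type u} (M : CoxeterMatrix B) (s : B) :
      ¬ IsSpherical (restrict M (perp M s)) → ClassT (restrict M {s}ᶜ) → ClassT M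
  | union {B : Type u} (M : CoxeterMatrix B) (S₁ S₂ : Set B) :
      S₁ ∪ S₂ = Set.univ → ClassT (restrict M S₁) → ClassT (restrict M S₂) →
      ¬ IsSpherical (restrict M (S₁ ∩ S₂)) → ClassT M

/-! ### Right-angled Coxeter groups -/

open Classical in
/-- The right-angled Coxeter matrix of a graph: adjacent vertices commute, and distinct non-adjacent
vertices satisfy no relation. -/
def racMatrix {V : Type u} (Γ : SimpleGraph V) : CoxeterMatrix V where
  M i j := if i = j then 1 else if Γ.Adj i j then 2 else 0
  isSymm := by ext i j; simp [Matrix.transpose, eq_comm, Γ.adj_comm]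
  diagonal i := by simp
  off_diagonal i j h := by simp only [h, if_false]; split <;> simp

/-- The class `𝒯` of thick graphs. In `cone`, the graph is obtained by coning off the subgraph that
is induced on the neighbours of `v`, with `v` as the cone point. In `union`, it is a generalized
union, along the subgraph induced on `V₁ ∩ V₂`, of the subgraphs induced on `V₁` and on `V₂`: edges
between `V₁ \ V₂` and `V₂ \ V₁` are arbitrary. -/
inductive ThickGraph : ∀ {V : Type u}, SimpleGraph V → Prop
  | square {V : Type u} (Γ : SimpleGraph V) :
      Nonempty (Γ ≃g completeBipartiteGraph (Fin 2) (Fin 2)) → ThickGraph Γ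
  | cone {V : Type u} (Γ : SimpleGraph V) (v : V) :
      ThickGraph (Γ.induce {v}ᶜ) → ¬ Γ.IsClique (Γ.neighborSet v) → ThickGraph Γ
  | union {V : Type u} (Γ : SimpleGraph V) (V₁ V₂ : Set V) :
      V₁ ∪ V₂ = Set.univ → ThickGraph (Γ.induce V₁) → ThickGraph (Γ.induce V₂) →
      ¬ Γ.IsClique (V₁ ∩ V₂) → ThickGraph Γ

end

end ThickCoxeter

namespace ThickCoxeter

noncomputable section

/-! ### The geometric representation -/

section Geometric

variable {B : Type u} (M : CoxeterMatrix B)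

/-! Thickness follows the inductive construction of the class. For `adjoin`, put P = W_{S∖s} and Q =
sPs. The subgroup generated by P and Q is normalised by s and has index at most 2, and P ∩ Q =
W_{s^⊥} is infinite and finitely generated. For `union`, the two parabolic subgroups generate W and
meet in W_{S₁∩S₂}. Parabolic subgroups are convex in the word metric and their conjugates are
quasiconvex, so `ThickOfOrderAtMost.of_pair` raises the order by one in both cases.

The base cases come from wideness of a product of two infinite finitely generated groups
(`isWide_prod`): its cones are products of connected spaces with more than one point, and removing a
point leaves such a product connected. This covers commuting parabolics directly. An irreducible
affine group acts discretely by isometries on a Euclidean space; the elements with trivial linear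
part form a torsion-free abelian subgroup of finite index. It is infinite, and it is not cyclic once
|S| ≥ 3 (`not_translations_cyclic`), so it is ℤⁿ with n ≥ 2, which is wide; the whole group is then
thick of order at most 1.

The facts on parabolic subgroups all rest on the geometric representation and on one theorem,
`rep_root_nonneg`: g sends a simple root to a non-negative vector unless that root is a right
descent of g.

Statement (b) is a case of (a): a non-clique contains two generators without relation, so it spans a
non-spherical subsystem, and the rules for graphs become the rules for Coxeter systems. -/

theorem formMatrix_comm (i j : B) : formMatrix M i j = formMatrix M j i := by
  simp only [formMatrix, M.symmetric i j]

@[simp] theorem formMatrix_self (i : B) : formMatrix M i i = 1 := by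
  simp [formMatrix]

theorem formMatrix_nonpos {i j : B} (h : i ≠ j) : formMatrix M i j ≤ 0 := by
  have h1 := M.off_diagonal i j h
  unfold formMatrix
  split_ifs with h0
  · norm_num
  · have h2 : (2 : ℝ) ≤ M i j := by
      have : 2 ≤ M i j := by omega
      exact_mod_cast this
    have : Real.pi / M i j ≤ Real.pi / 2 := by gcongr
    have h3 : 0 ≤ Real.pi / M i j := by positivity
    have := Real.cos_nonneg_of_mem_Icc (x := Real.pi / M i j) ⟨by linarith [Real.pi_pos], this⟩
    linarith

theorem formMatrix_eq_zero_iff {i j : B} : formMatrix M i j = 0 ↔ M i j = 2 := by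
  by_cases hij : i = j
  · subst hij; simp
  have h1 := M.off_diagonal i j hij
  unfold formMatrix
  split_ifs with h0
  · simp [h0]
  · constructor
    · intro h
      by_contra h2
      have h3 : (2 : ℝ) < M i j := by
        have : 2 < M i j := by omega
        exact_mod_cast this
      have h4 : Real.pi / M i j < Real.pi / 2 := by gcongr
      have h5 : 0 ≤ Real.pi / M i j := by positivity
      have := Real.cos_pos_of_mem_Ioo (x := Real.pi / M i j) ⟨by linarith [Real.pi_pos], h4⟩
      linarith
    · intro h
      simp [h]

/-- The bilinear form of the Coxeter system. -/
def form : (B →₀ ℝ) →ₗ[ℝ] (B →₀ ℝ) →ₗ[ℝ] ℝ :=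
  Finsupp.linearCombination ℝ fun i => Finsupp.linearCombination ℝ fun j => formMatrix M i j

/-- The simple roots. -/
def root (i : B) : B →₀ ℝ := Finsupp.single i 1

@[simp] theorem form_root_root (i j : B) : form M (root i) (root j) = formMatrix M i j := by
  simp [form, root]

theorem hom_ext_root {E : Type*} [AddCommMonoid E] [Module ℝ E] {f g : (B →₀ ℝ) →ₗ[ℝ] E}
    (h : ∀ i, f (root i) = g (root i)) : f = g :=
  Finsupp.lhom_ext' fun i => LinearMap.ext_ring (h i)

theorem form_comm (x y : B →₀ ℝ) : form M x y = form M y x := by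
  have : form M = (form M).flip := hom_ext_root fun i => hom_ext_root fun j => by
    simp [formMatrix_comm M i j]
  exact congrArg (fun f => f x y) this

/-- The reflection in a vector `b` (of square norm `1`). -/
def reflect (b : B →₀ ℝ) : Module.End ℝ (B →₀ ℝ) :=
  LinearMap.id - (2 : ℝ) • ((form M).flip b).smulRight b

theorem reflect_apply (b x : B →₀ ℝ) : reflect M b x = x - (2 * form M x b) • b := by
  simp [reflect, mul_smul]

theorem form_reflect (b x y : B →₀ ℝ) (hb : form M b b = 1) :
    form M (reflect M b x) (reflect M b y) = form M x y := by
  simp only [reflect_apply, map_sub, map_smul, LinearMap.sub_apply, LinearMap.smul_apply,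
    smul_eq_mul, hb, form_comm M b y]
  ring

theorem reflect_reflect (b x : B →₀ ℝ) (hb : form M b b = 1) :
    reflect M b (reflect M b x) = x := by
  simp only [reflect_apply, map_sub, map_smul, hb]
  module

theorem reflect_smul_add_smul_left (x y : B →₀ ℝ) (hx : form M x x = 1) (a b : ℝ) :
    reflect M x (a • x + b • y) = (-a - 2 * form M y x * b) • x + b • y := by
  simp only [reflect_apply, map_add, map_smul]
  simp only [hx]
  module

theorem reflect_smul_add_smul_right (x y : B →₀ ℝ) (hy : form M y y = 1) (a b : ℝ) :
    reflect M y (a • x + b • y) = a • x + (-b - 2 * form M x y * a) • y := by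
  rw [add_comm, reflect_smul_add_smul_left M y x hy, add_comm]

theorem reflect_mul_reflect_pow_apply_of_orthogonal (x y z : B →₀ ℝ)
    (hx : form M z x = 0) (hy : form M z y = 0) (m : ℕ) :
    ((reflect M x * reflect M y) ^ m) z = z := by
  rw [Module.End.pow_apply]
  exact Function.iterate_fixed (by simp [reflect_apply, hx, hy]) m

/-- The product of the two reflections rotates by 2θ. In the coordinates (sin(φ+θ), sin φ) this is
the shift φ ↦ φ + 2θ, since each reflection replaces one coordinate by the next term of the sequence
sin(φ + kθ). -/
theorem reflect_mul_reflect_pow_apply (x y : B →₀ ℝ) (hx : form M x x = 1) (hy : form M y y = 1)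
    (θ : ℝ) (hxy : form M x y = -Real.cos θ) (k : ℕ) (φ : ℝ) :
    ((reflect M x * reflect M y) ^ k) (Real.sin (φ + θ) • x + Real.sin φ • y) =
      Real.sin (φ + k * (2 * θ) + θ) • x + Real.sin (φ + k * (2 * θ)) • y := by
  have hsq : Real.cos θ ^ 2 = 1 - Real.sin θ ^ 2 := by
    have := Real.sin_sq_add_cos_sq θ; linarith
  have key : ∀ ψ, -Real.sin ψ - 2 * -Real.cos θ * Real.sin (ψ + θ) = Real.sin (ψ + θ + θ) := by
    intro ψ
    simp only [Real.sin_add, Real.cos_add]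
    linear_combination Real.sin ψ * hsq
  induction k generalizing φ with
  | zero => simp
  | succ k ih =>
    rw [pow_succ, Module.End.mul_apply, Module.End.mul_apply,
      reflect_smul_add_smul_right M x y hy, hxy, key,
      reflect_smul_add_smul_left M x y hx, form_comm M y x, hxy, key,
      show φ + θ + θ + θ = (φ + 2 * θ) + θ by ring, show φ + θ + θ = φ + 2 * θ by ring, ih]
    rw [show φ + 2 * θ + k * (2 * θ) = φ + ((k + 1 : ℕ) : ℝ) * (2 * θ) by push_cast; ring]

/-- The plane of the two roots is rotated by 2π/m, its orthogonal complement is fixed, and the two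
span everything because the form on the plane has determinant sin²θ ≠ 0. -/
theorem reflect_mul_reflect_pow (i j : B) :
    (reflect M (root i) * reflect M (root j)) ^ M i j = 1 := by
  by_cases hij : i = j
  · subst hij
    rw [M.diagonal, pow_one]
    exact LinearMap.ext fun x => reflect_reflect M (root i) x (by simp)
  by_cases h0 : M i j = 0
  · rw [h0, pow_zero]
  have h1 := M.off_diagonal i j hij
  have h2 : (2 : ℝ) ≤ M i j := by
    have : 2 ≤ M i j := by omega
    exact_mod_cast this
  have hmθ : M i j * (Real.pi / M i j) = Real.pi := by field_simp
  have hc : formMatrix M i j = -Real.cos (Real.pi / M i j) := by rw [formMatrix, if_neg h0]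
  have hθ0 : 0 < Real.pi / M i j := by positivity
  have hθ1 : Real.pi / M i j ≤ Real.pi / 2 := by gcongr
  revert hmθ hc hθ0 hθ1
  generalize Real.pi / (M i j : ℝ) = θ
  generalize M i j = m
  intro hmθ hc hθ0 hθ1
  have hs : 0 < Real.sin θ := Real.sin_pos_of_pos_of_lt_pi hθ0 (by linarith [Real.pi_pos])
  have hsq : Real.cos θ ^ 2 = 1 - Real.sin θ ^ 2 := by
    have := Real.sin_sq_add_cos_sq θ; linarith
  have hper : ∀ φ, ((reflect M (root i) * reflect M (root j)) ^ m)
      (Real.sin (φ + θ) • root i + Real.sin φ • root j) =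
        Real.sin (φ + θ) • root i + Real.sin φ • root j := by
    intro φ
    rw [reflect_mul_reflect_pow_apply M _ _ (by simp) (by simp) θ (by simpa using hc),
      show φ + m * (2 * θ) = φ + 2 * Real.pi by rw [← hmθ]; ring,
      show φ + 2 * Real.pi + θ = φ + θ + 2 * Real.pi by ring, Real.sin_add_two_pi,
      Real.sin_add_two_pi]
  -- The phases 0 and π − θ give multiples by sin θ of the two roots.
  have hri : ((reflect M (root i) * reflect M (root j)) ^ m) (root i) = root i := by
    have := hper 0
    rw [zero_add, Real.sin_zero, zero_smul, add_zero, map_smul] at this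
    exact smul_right_injective _ hs.ne' this
  have hrj : ((reflect M (root i) * reflect M (root j)) ^ m) (root j) = root j := by
    have := hper (Real.pi - θ)
    rw [sub_add_cancel, Real.sin_pi, zero_smul, zero_add, map_smul, Real.sin_pi_sub] at this
    exact smul_right_injective _ hs.ne' this
  refine LinearMap.ext fun x => ?_
  rw [Module.End.one_apply]
  -- Here a and b are the coefficients of the orthogonal projection of x to the plane, found by
  -- inverting its Gram matrix.
  obtain ⟨a, ha⟩ : ∃ a, a * Real.sin θ ^ 2 =
      form M x (root i) + Real.cos θ * form M x (root j) :=
    ⟨_, div_mul_cancel₀ _ (by positivity)⟩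
  obtain ⟨b, hb⟩ : ∃ b, b * Real.sin θ ^ 2 =
      form M x (root j) + Real.cos θ * form M x (root i) :=
    ⟨_, div_mul_cancel₀ _ (by positivity)⟩
  have hab : form M x (root i) = a - Real.cos θ * b ∧
      form M x (root j) = b - Real.cos θ * a := by
    constructor <;> apply mul_right_cancel₀ (b := Real.sin θ ^ 2) (by positivity)
    · linear_combination -ha + Real.cos θ * hb + form M x (root i) * hsq
    · linear_combination -hb + Real.cos θ * ha + form M x (root j) * hsq
  have hy := reflect_mul_reflect_pow_apply_of_orthogonal M (root i) (root j)
    (x - (a • root i + b • root j))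
    (by
      simp only [map_sub, map_add, map_smul, LinearMap.sub_apply, LinearMap.add_apply,
        LinearMap.smul_apply, smul_eq_mul, form_root_root, formMatrix_self, hab.1,
        formMatrix_comm M j i, hc]
      ring)
    (by
      simp only [map_sub, map_add, map_smul, LinearMap.sub_apply, LinearMap.add_apply,
        LinearMap.smul_apply, smul_eq_mul, form_root_root, formMatrix_self, hab.2, hc]
      ring) m
  rw [map_sub, map_add, map_smul, map_smul, hri, hrj] at hy
  exact sub_left_injective hy

/-- The geometric representation of a Coxeter group. -/
def rep : M.Group →* Module.End ℝ (B →₀ ℝ) :=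
  M.toCoxeterSystem.lift ⟨fun i => reflect M (root i), reflect_mul_reflect_pow M⟩

@[simp] theorem rep_simple (i : B) : rep M (M.simple i) = reflect M (root i) := by
  rw [← M.toCoxeterSystem_simple]
  exact M.toCoxeterSystem.lift_apply_simple (reflect_mul_reflect_pow M) i

theorem rep_mul_apply (g h : M.Group) (x : B →₀ ℝ) : rep M (g * h) x = rep M g (rep M h x) := by
  rw [map_mul, Module.End.mul_apply]

@[simp] theorem rep_inv_apply_rep (g : M.Group) (x : B →₀ ℝ) : rep M g⁻¹ (rep M g x) = x := by
  rw [← rep_mul_apply, inv_mul_cancel, map_one, Module.End.one_apply]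

@[simp] theorem rep_apply_rep_inv (g : M.Group) (x : B →₀ ℝ) : rep M g (rep M g⁻¹ x) = x := by
  rw [← rep_mul_apply, mul_inv_cancel, map_one, Module.End.one_apply]

theorem group_induction_right {p : M.Group → Prop} (g : M.Group) (one : p 1)
    (mul_simple : ∀ g i, p g → p (g * M.simple i)) : p g :=
  M.toCoxeterSystem.simple_induction_right g one fun g i h => by
    rw [M.toCoxeterSystem_simple]; exact mul_simple g i h

theorem form_rep (g : M.Group) (x y : B →₀ ℝ) : form M (rep M g x) (rep M g y) = form M x y := by
  induction g using group_induction_right generalizing x y with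
  | one => simp
  | mul_simple g i ih =>
    rw [rep_mul_apply, rep_mul_apply, ih, rep_simple, form_reflect M _ _ _ (by simp)]

theorem reflect_rep (g : M.Group) (b x : B →₀ ℝ) :
    reflect M (rep M g b) (rep M g x) = rep M g (reflect M b x) := by
  simp [reflect_apply, form_rep]

theorem rep_conj_simple (g : M.Group) (i : B) :
    rep M (g * M.simple i * g⁻¹) = reflect M (rep M g (root i)) := by
  refine LinearMap.ext fun x => ?_
  obtain ⟨y, rfl⟩ : ∃ y, x = rep M g y := ⟨rep M g⁻¹ x, by simp⟩
  rw [rep_mul_apply, rep_inv_apply_rep, rep_mul_apply, rep_simple, reflect_rep]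

@[simp] theorem simple_mul_self (i : B) : M.simple i * M.simple i = 1 := by
  rw [← M.toCoxeterSystem_simple]; exact M.toCoxeterSystem.simple_mul_simple_self i

@[simp] theorem simple_inv (i : B) : (M.simple i)⁻¹ = M.simple i := by
  rw [← M.toCoxeterSystem_simple]; exact M.toCoxeterSystem.inv_simple i

@[simp] theorem simple_mul_simple_mul (i : B) (g : M.Group) :
    M.simple i * (M.simple i * g) = g := by
  rw [← mul_assoc, simple_mul_self, one_mul]

/-! ### Positivity of roots -/

/-- The coefficients of the roots of a dihedral group. -/
theorem exists_dihedral_coeff (i j : B) (hij : i ≠ j) : ∃ A : ℕ → ℝ, A 0 = 0 ∧ A 1 = 1 ∧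
    (∀ k, A (k + 2) = -2 * formMatrix M i j * A (k + 1) - A k) ∧
    ∀ k, (M i j ≠ 0 → k ≤ M i j) → 0 ≤ A k := by
  by_cases h0 : M i j = 0
  -- Without a relation the form is −1, and the recursion is that of arithmetic progressions.
  · refine ⟨fun k => k, by simp, by simp, fun k => ?_, fun k _ => by positivity⟩
    simp [formMatrix, h0]; ring
  · have h1 := M.off_diagonal i j hij
    have h2 : (2 : ℝ) ≤ M i j := by
      have : 2 ≤ M i j := by omega
      exact_mod_cast this
    set θ := Real.pi / M i j with hθ
    have hmθ : M i j * θ = Real.pi := by rw [hθ]; field_simp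
    have hθ0 : 0 < θ := by positivity
    have hθ1 : θ ≤ Real.pi / 2 := by rw [hθ]; gcongr
    have hs : 0 < Real.sin θ := Real.sin_pos_of_pos_of_lt_pi hθ0 (by linarith [Real.pi_pos])
    have hc : formMatrix M i j = -Real.cos θ := by rw [formMatrix, if_neg h0]
    -- Chebyshev recursion; the sign is right as long as kθ ≤ π, that is, k ≤ m.
    refine ⟨fun k => Real.sin (k * θ) / Real.sin θ, by simp, by simp [hs.ne'], fun k => ?_,
      fun k hk => ?_⟩
    · rw [hc]
      dsimp only
      have e1 : ((k + 2 : ℕ) : ℝ) * θ = (k * θ + θ) + θ := by push_cast; ring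
      have e2 : ((k + 1 : ℕ) : ℝ) * θ = k * θ + θ := by push_cast; ring
      rw [e1, e2]
      generalize (k : ℝ) * θ = ψ
      have hsq := Real.sin_sq_add_cos_sq θ
      field_simp
      simp only [Real.sin_add, Real.cos_add]
      linear_combination (-Real.sin ψ) * hsq
    · have hk' : (k : ℝ) ≤ M i j := by exact_mod_cast hk h0
      apply div_nonneg _ hs.le
      apply Real.sin_nonneg_of_nonneg_of_le_pi (by positivity)
      rw [← hmθ]; gcongr

open CoxeterSystem in
theorem rep_alternatingWord (i j : B) {A : ℕ → ℝ} (h0 : A 0 = 0) (h1 : A 1 = 1)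
    (hA : ∀ k, A (k + 2) = -2 * formMatrix M i j * A (k + 1) - A k) (k : ℕ) :
    rep M (M.toCoxeterSystem.wordProd (alternatingWord i j k)) (root i) =
      if Even k then A (k + 1) • root i + A k • root j
      else A k • root i + A (k + 1) • root j := by
  induction k with
  | zero => simp [alternatingWord, h0, h1]
  | succ k ih =>
    rw [alternatingWord_succ', M.toCoxeterSystem.wordProd_cons, M.toCoxeterSystem_simple,
      rep_mul_apply, ih]
    by_cases hk : Even k
    · have hk' : ¬ Even (k + 1) := by simpa [Nat.even_add_one] using hk
      rw [if_pos hk, if_pos hk, if_neg hk', rep_simple, reflect_apply, hA]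
      simp only [map_add, map_smul, LinearMap.add_apply, LinearMap.smul_apply,
        smul_eq_mul, form_root_root, formMatrix_self]
      module
    · have hk' : Even (k + 1) := by simpa [Nat.even_add_one] using hk
      rw [if_neg hk, if_neg hk, if_pos hk', rep_simple, reflect_apply, hA]
      simp only [map_add, map_smul, LinearMap.add_apply, LinearMap.smul_apply,
        smul_eq_mul, form_root_root, formMatrix_self, formMatrix_comm M j i]
      module

open CoxeterSystem in
-- A right descent, once stripped, is no longer one, so only the other letter needs testing.
-- Stripping j, i, j, … in turn ends at an h with neither descent, the shortest element of its coset
-- of the dihedral subgroup.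
theorem exists_strip_alternatingWord (n : ℕ) (i j : B) (g : M.Group)
    (hn : M.toCoxeterSystem.length g = n) (hi : ¬ M.toCoxeterSystem.IsRightDescent g i) :
    ∃ (k : ℕ) (h : M.Group), g = h * M.toCoxeterSystem.wordProd (alternatingWord i j k) ∧
      M.toCoxeterSystem.length g = M.toCoxeterSystem.length h + k ∧
      ¬ M.toCoxeterSystem.IsRightDescent h i ∧ ¬ M.toCoxeterSystem.IsRightDescent h j := by
  induction n generalizing i j g with
  | zero =>
    exact ⟨0, g, by simp [alternatingWord], by simp, hi, by
      unfold IsRightDescent; omega⟩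
  | succ n ih =>
    by_cases hj : M.toCoxeterSystem.IsRightDescent g j
    · have hl := (M.toCoxeterSystem.isRightDescent_iff).1 hj
      obtain ⟨k, h, hg, hk, h1, h2⟩ := ih j i (g * M.toCoxeterSystem.simple j) (by omega)
        ((M.toCoxeterSystem.isRightDescent_iff_not_isRightDescent_mul).1 hj)
      refine ⟨k + 1, h, ?_, by omega, h2, h1⟩
      rw [alternatingWord_succ, M.toCoxeterSystem.wordProd_concat, ← mul_assoc, ← hg,
        M.toCoxeterSystem.simple_mul_simple_cancel_right]
    · exact ⟨0, g, by simp [alternatingWord], by simp, hi, hj⟩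

@[simp] theorem root_apply_self (i : B) : root i i = 1 := by simp [root]

theorem root_apply_of_ne {i j : B} (h : i ≠ j) : root i j = 0 := by simp [root, h]

theorem root_nonneg (i : B) : 0 ≤ root i := by
  intro j
  by_cases h : i = j <;> simp [root, h]

open CoxeterSystem in
-- Induction on length. Strip from g an alternating word in i and a right descent j: the remaining h
-- is shorter and sends both roots to non-negative vectors, while the dihedral word sends `root i`
-- to a non-negative combination of the two.
theorem rep_root_nonneg {g : M.Group} {i : B} (hi : ¬ M.toCoxeterSystem.IsRightDescent g i) :
    0 ≤ rep M g (root i) := by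
  induction hn : M.toCoxeterSystem.length g using Nat.strong_induction_on generalizing g i with
  | _ n ih =>
  by_cases hg : g = 1
  · subst hg; simpa using root_nonneg i
  obtain ⟨j, hj⟩ := M.toCoxeterSystem.exists_rightDescent_of_ne_one hg
  have hij : i ≠ j := by rintro rfl; exact hi hj
  obtain ⟨k, h, rfl, hk, h1, h2⟩ := exists_strip_alternatingWord M n i j g hn hi
  have hk0 : k ≠ 0 := by
    rintro rfl
    apply h2
    simpa [alternatingWord] using hj
  have hi1 := ih _ (by omega) h1 rfl
  have hj1 := ih _ (by omega) h2 rfl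
  obtain ⟨A, hA0, hA1, hA, hpos⟩ := exists_dihedral_coeff M i j hij
  -- If k + 1 exceeded m, appending i would give a non-reduced alternating word, and g·sᵢ could not
  -- be longer than g.
  have hkm : M i j ≠ 0 → k + 1 ≤ M i j := by
    intro h0
    by_contra hlt
    have hred := M.toCoxeterSystem.not_isReduced_alternatingWord j i (m := k + 1)
      (by rwa [M.symmetric]) (by rw [M.symmetric]; omega)
    have hle := M.toCoxeterSystem.length_wordProd_le (alternatingWord j i (k + 1))
    rw [length_alternatingWord] at hle
    rw [CoxeterSystem.IsReduced, length_alternatingWord] at hred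
    have hl := (M.toCoxeterSystem.not_isRightDescent_iff).1 hi
    rw [mul_assoc, ← M.toCoxeterSystem.wordProd_concat, ← alternatingWord_succ] at hl
    have := M.toCoxeterSystem.length_mul_le h
      (M.toCoxeterSystem.wordProd (alternatingWord j i (k + 1)))
    omega
  have ha := hpos (k + 1) hkm
  have hb := hpos k fun h => by have := hkm h; omega
  rw [rep_mul_apply, rep_alternatingWord M i j hA0 hA1 hA]
  split_ifs
  · rw [map_add, map_smul, map_smul]
    exact add_nonneg (smul_nonneg ha hi1) (smul_nonneg hb hj1)
  · rw [map_add, map_smul, map_smul]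
    exact add_nonneg (smul_nonneg hb hi1) (smul_nonneg ha hj1)

open CoxeterSystem in
theorem rep_root_nonpos {g : M.Group} {i : B} (hi : M.toCoxeterSystem.IsRightDescent g i) :
    rep M g (root i) ≤ 0 := by
  have h := rep_root_nonneg M ((M.toCoxeterSystem.isRightDescent_iff_not_isRightDescent_mul).1 hi)
  rw [M.toCoxeterSystem_simple, rep_mul_apply, rep_simple, reflect_apply, form_root_root,
    formMatrix_self] at h
  have e : root i - ((2 * 1 : ℝ)) • root i = - root i := by module
  rw [e, map_neg] at h
  exact neg_nonneg.1 h

theorem rep_root_nonneg_or_nonpos (g : M.Group) (i : B) :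
    0 ≤ rep M g (root i) ∨ rep M g (root i) ≤ 0 := by
  by_cases h : M.toCoxeterSystem.IsRightDescent g i
  · exact Or.inr (rep_root_nonpos M h)
  · exact Or.inl (rep_root_nonneg M h)

theorem root_ne_nonpos (i : B) : ¬ root i ≤ 0 := by
  intro h
  have := h i
  simp [root] at this
  linarith

/-- A non-trivial element has a right descent, and sends that simple root to a non-positive vector.
-/
theorem rep_injective : Function.Injective (rep M) := by
  rw [injective_iff_map_eq_one]
  intro g hg
  by_contra h
  obtain ⟨i, hi⟩ := M.toCoxeterSystem.exists_rightDescent_of_ne_one h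
  have := rep_root_nonpos M hi
  rw [hg] at this
  exact root_ne_nonpos i this

theorem rep_ext {g h : M.Group} (H : ∀ i, rep M g (root i) = rep M h (root i)) : g = h :=
  rep_injective M (hom_ext_root H)

end Geometric

/-! ### Parabolic subgroups -/

section Parabolic

variable {B : Type u} (M : CoxeterMatrix B)

theorem simple_mem_parabolic {J : Set B} {i : B} (hi : i ∈ J) : M.simple i ∈ parabolic M J :=
  Subgroup.subset_closure ⟨i, hi, rfl⟩

theorem parabolic_mono {J K : Set B} (h : J ⊆ K) : parabolic M J ≤ parabolic M K :=
  Subgroup.closure_mono (Set.image_mono h)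

theorem closure_range_simple : Subgroup.closure (Set.range M.simple) = ⊤ := by
  have := M.toCoxeterSystem.subgroup_closure_range_simple
  rwa [M.toCoxeterSystem_simple] at this

theorem parabolic_univ : parabolic M Set.univ = ⊤ := by
  rw [parabolic, Set.image_univ, closure_range_simple]

theorem parabolic_sup (J K : Set B) : parabolic M J ⊔ parabolic M K = parabolic M (J ∪ K) := by
  rw [parabolic, parabolic, parabolic, ← Subgroup.closure_union, Set.image_union]

theorem rep_apply_of_mem_parabolic {J : Set B} {g : M.Group} (hg : g ∈ parabolic M J)
    {j : B} (hj : j ∉ J) (x : B →₀ ℝ) : rep M g x j = x j := by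
  unfold parabolic at hg
  induction hg using Subgroup.closure_induction generalizing x with
  | mem g hg =>
    obtain ⟨i, hi, rfl⟩ := hg
    have : i ≠ j := by rintro rfl; exact hj hi
    simp [reflect_apply, root, this]
  | one => simp
  | mul g h _ _ ihg ihh => rw [rep_mul_apply, ihg, ihh]
  | inv g _ ih => rw [← ih, rep_apply_rep_inv]

/-- Elements of W_J change only coordinates in J. For i outside J the i-th coordinate of the image
of `root i` would stay 1, although a descent makes it non-positive. -/
theorem mem_of_isRightDescent {J : Set B} {g : M.Group} (hg : g ∈ parabolic M J) {i : B}
    (hi : M.toCoxeterSystem.IsRightDescent g i) : i ∈ J := by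
  by_contra h
  have h1 := rep_root_nonpos M hi i
  rw [rep_apply_of_mem_parabolic M hg h] at h1
  simp [root] at h1
  linarith

/-- Descents of elements of W_J lie in J, so letters can be stripped without leaving W_J. -/
theorem parabolic_induction {J : Set B} {p : M.Group → Prop} (one : p 1)
    (mul_simple : ∀ g ∈ parabolic M J, ∀ i ∈ J, M.toCoxeterSystem.IsRightDescent g i →
      p (g * M.simple i) → p g) : ∀ g ∈ parabolic M J, p g := by
  intro g hg
  induction hn : M.toCoxeterSystem.length g using Nat.strong_induction_on generalizing g with
  | _ n ih =>
  by_cases h1 : g = 1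
  · rwa [h1]
  obtain ⟨i, hi⟩ := M.toCoxeterSystem.exists_rightDescent_of_ne_one h1
  have hiJ := mem_of_isRightDescent M hg hi
  refine mul_simple g hg i hiJ hi (ih _ ?_ _ (mul_mem hg (simple_mem_parabolic M hiJ)) rfl)
  rw [CoxeterSystem.IsRightDescent, M.toCoxeterSystem_simple] at hi
  omega

theorem parabolic_inf (J K : Set B) : parabolic M J ⊓ parabolic M K = parabolic M (J ∩ K) := by
  apply le_antisymm
  · rintro g ⟨hJ, hK⟩
    revert hK
    refine parabolic_induction M (p := fun g => g ∈ parabolic M K → g ∈ parabolic M (J ∩ K))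
      (fun _ => one_mem _) ?_ g hJ
    intro g _ i hi hd ih hK
    have hiK := mem_of_isRightDescent M hK hd
    have := mul_mem (ih (mul_mem hK (simple_mem_parabolic M hiK)))
      (simple_mem_parabolic M (J := J ∩ K) ⟨hi, hiK⟩)
    rwa [mul_assoc, simple_mul_self, mul_one] at this
  · exact le_inf (parabolic_mono M Set.inter_subset_left) (parabolic_mono M Set.inter_subset_right)

theorem exists_word_of_mem_parabolic {J : Set B} (g : M.Group) (hg : g ∈ parabolic M J) :
    ∃ ω : List B, (∀ i ∈ ω, i ∈ J) ∧ M.toCoxeterSystem.wordProd ω = g ∧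
      ω.length = M.toCoxeterSystem.length g := by
  refine parabolic_induction M (p := fun g => ∃ ω : List B, (∀ i ∈ ω, i ∈ J) ∧
    M.toCoxeterSystem.wordProd ω = g ∧ ω.length = M.toCoxeterSystem.length g)
    ⟨[], by simp⟩ ?_ g hg
  rintro g _ i hi hd ⟨ω, hω, hg, hl⟩
  refine ⟨ω.concat i, ?_, ?_, ?_⟩
  · simp only [List.concat_eq_append, List.mem_append, List.mem_singleton]
    rintro j (hj | rfl)
    exacts [hω j hj, hi]
  · rw [M.toCoxeterSystem.wordProd_concat, hg, M.toCoxeterSystem_simple, mul_assoc,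
      simple_mul_self, mul_one]
  · rw [List.length_concat, hl, ← (M.toCoxeterSystem.isRightDescent_iff).1 hd,
      M.toCoxeterSystem_simple]

theorem simple_mul_simple_pow (i j : B) : (M.simple i * M.simple j) ^ M i j = 1 := by
  have := M.toCoxeterSystem.simple_mul_simple_pow i j
  rwa [M.toCoxeterSystem_simple] at this

/-- The homomorphism from the Coxeter group of a subsystem. -/
def parabolicHom (J : Set B) : (restrict M J).Group →* M.Group :=
  (restrict M J).toCoxeterSystem.lift ⟨fun i => M.simple i, fun i j => simple_mul_simple_pow M i j⟩

@[simp] theorem parabolicHom_simple (J : Set B) (i : J) :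
    parabolicHom M J ((restrict M J).simple i) = M.simple i := by
  rw [← (restrict M J).toCoxeterSystem_simple]
  exact (restrict M J).toCoxeterSystem.lift_apply_simple (f := fun i : J => M.simple i)
    (fun i j => simple_mul_simple_pow M i j) i

theorem range_parabolicHom (J : Set B) : (parabolicHom M J).range = parabolic M J := by
  rw [MonoidHom.range_eq_map, ← closure_range_simple, MonoidHom.map_closure, parabolic,
    ← Set.range_comp]
  congr 1
  ext g
  simp

theorem mapDomain_root (J : Set B) (i : J) :
    Finsupp.lmapDomain ℝ ℝ (Subtype.val : J → B) (root i) = root (i : B) := by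
  simp [root]

theorem form_mapDomain (J : Set B) (x y : J →₀ ℝ) :
    form M (Finsupp.lmapDomain ℝ ℝ Subtype.val x) (Finsupp.lmapDomain ℝ ℝ Subtype.val y) =
      form (restrict M J) x y := by
  have : (form M).compl₁₂ (Finsupp.lmapDomain ℝ ℝ Subtype.val)
      (Finsupp.lmapDomain ℝ ℝ Subtype.val) = form (restrict M J) :=
    hom_ext_root fun i => hom_ext_root fun j => by
      rw [LinearMap.compl₁₂_apply, mapDomain_root, mapDomain_root, form_root_root, form_root_root]
      rfl
  exact congrArg (fun f => f x y) this

theorem rep_parabolicHom (J : Set B) (g : (restrict M J).Group) (x : J →₀ ℝ) :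
    rep M (parabolicHom M J g) (Finsupp.lmapDomain ℝ ℝ Subtype.val x) =
      Finsupp.lmapDomain ℝ ℝ Subtype.val (rep (restrict M J) g x) := by
  induction g using group_induction_right generalizing x with
  | one => simp only [map_one, Module.End.one_apply]
  | mul_simple g i ih =>
    rw [map_mul, rep_mul_apply, rep_mul_apply, parabolicHom_simple, rep_simple, rep_simple,
      reflect_apply, reflect_apply, ← form_mapDomain, mapDomain_root, map_sub, map_smul, map_sub,
      map_smul, map_sub, map_smul, ih, ← ih (root i), mapDomain_root]

/-- The geometric representation of the subsystem embeds equivariantly in that of the whole system,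
and it is faithful. -/
theorem parabolicHom_injective (J : Set B) : Function.Injective (parabolicHom M J) := by
  rw [injective_iff_map_eq_one]
  intro g hg
  refine rep_ext _ fun i => ?_
  have := rep_parabolicHom M J g (root i)
  rw [hg, map_one, Module.End.one_apply] at this
  rw [map_one, Module.End.one_apply]
  exact (Finsupp.mapDomain_injective Subtype.val_injective this).symm

/-- `(W_J, J)` is a Coxeter system. -/
def parabolicEquiv (J : Set B) : (restrict M J).Group ≃* parabolic M J :=
  (MonoidHom.ofInjective (parabolicHom_injective M J)).trans
    (MulEquiv.subgroupCongr (range_parabolicHom M J))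

theorem infinite_parabolic {J : Set B} (h : ¬ IsSpherical (restrict M J)) :
    Infinite (parabolic M J) := by
  rw [IsSpherical, not_finite_iff_infinite] at h
  exact (parabolicEquiv M J).toEquiv.infinite_iff.1 h

/-! ### Commuting generators and the conjugate of a maximal parabolic subgroup -/

theorem simple_conj_of_mem_perp {s t : B} (h : t ∈ perp M s) :
    M.simple s * M.simple t * M.simple s = M.simple t := by
  have h2 : M s t = 2 := h
  have := simple_mul_simple_pow M s t
  rw [h2, pow_two, ← mul_assoc] at this
  have h3 := eq_inv_of_mul_eq_one_left this
  rwa [simple_inv] at h3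

theorem eq_two_of_commute {i j : B} (hij : i ≠ j) (h : Commute (M.simple i) (M.simple j)) :
    M i j = 2 := by
  -- The coefficient of `root i` is 2·⟨i, j⟩ for one order of the product and −2·⟨i, j⟩ for the
  -- other.
  have h1 := congrArg (fun g => rep M g (root j) i) h.eq
  simp only [rep_mul_apply, rep_simple, reflect_apply, map_sub, map_smul,
    form_root_root, formMatrix_self, smul_eq_mul, Finsupp.sub_apply, Finsupp.smul_apply,
    root_apply_self, root_apply_of_ne hij.symm, formMatrix_comm M j i] at h1
  rw [← formMatrix_eq_zero_iff]
  linarith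

/-- Every right descent t of an element g of the intersection is orthogonal to s. Then s commutes
with t, the letter t can be stripped inside both groups, and induction applies. -/
theorem parabolic_inf_conj (s : B) :
    parabolic M {s}ᶜ ⊓ (parabolic M {s}ᶜ).map (MulAut.conj (M.simple s)).toMonoidHom =
      parabolic M (perp M s) := by
  have hmem : ∀ g, g ∈ (parabolic M {s}ᶜ).map (MulAut.conj (M.simple s)).toMonoidHom ↔
      M.simple s * g * M.simple s ∈ parabolic M {s}ᶜ := by
    intro g
    rw [Subgroup.mem_map]
    constructor
    · rintro ⟨h, hh, rfl⟩
      simpa [mul_assoc] using hh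
    · intro h
      exact ⟨_, h, by simp [mul_assoc]⟩
  apply le_antisymm
  · rintro g ⟨hg, hg'⟩
    replace hg' := (hmem g).1 hg'
    revert hg'
    refine parabolic_induction M (p := fun g => M.simple s * g * M.simple s ∈ parabolic M {s}ᶜ →
      g ∈ parabolic M (perp M s)) (fun _ => one_mem _) ?_ g hg
    intro g hg t ht hd ih hg'
    -- As g lies in W_{S∖s}, s is not a left descent of g: multiplying by s lengthens g by one, and
    -- lengthens the shorter g·t by at most one.
    have hd' : M.toCoxeterSystem.IsRightDescent (M.simple s * g) t := by
      have h1 : ¬ M.toCoxeterSystem.IsLeftDescent g s := by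
        rw [← M.toCoxeterSystem.isRightDescent_inv_iff]
        intro h
        exact mem_of_isRightDescent M (inv_mem hg) h rfl
      have h2 := (M.toCoxeterSystem.not_isLeftDescent_iff).1 h1
      have h3 := M.toCoxeterSystem.length_mul_le (M.simple s) (g * M.simple t)
      have h4 := M.toCoxeterSystem.length_simple s
      rw [CoxeterSystem.IsRightDescent] at hd ⊢
      rw [M.toCoxeterSystem_simple] at *
      rw [mul_assoc]
      omega
    have hs : s ∉ ({s}ᶜ : Set B) := by simp
    -- The s-coordinate of sg(`root t`) is non-positive. Since sgs fixes s-coordinates, it equals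
    -- that of s(`root t`), which is −2⟨t, s⟩ ≥ 0. Hence ⟨t, s⟩ = 0.
    have h1 := rep_root_nonpos M hd' s
    have h2 := rep_apply_of_mem_parabolic M hg' hs (rep M (M.simple s) (root t))
    rw [← rep_mul_apply, mul_assoc, simple_mul_self, mul_one] at h2
    have hst : t ≠ s := ht
    rw [h2, rep_simple, reflect_apply] at h1
    simp only [form_root_root, Finsupp.sub_apply, Finsupp.smul_apply, root_apply_self,
      root_apply_of_ne hst, smul_eq_mul, Finsupp.coe_zero, Pi.zero_apply] at h1
    have h3 : formMatrix M s t = 0 := by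
      have := formMatrix_nonpos M hst
      rw [formMatrix_comm]
      linarith
    have hperp : t ∈ perp M s := (formMatrix_eq_zero_iff M).1 h3
    have hconj := simple_conj_of_mem_perp M hperp
    have h5 := ih (by
      have := mul_mem hg' (simple_mem_parabolic M ht)
      rw [← hconj] at this
      simpa [mul_assoc] using this)
    have := mul_mem h5 (simple_mem_parabolic M hperp)
    rwa [mul_assoc, simple_mul_self, mul_one] at this
  · have hsub : perp M s ⊆ {s}ᶜ := by
      rintro t ht rfl
      have : M t t = 2 := ht
      simp at this
    refine le_inf (parabolic_mono M hsub) ?_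
    rw [parabolic, Subgroup.closure_le]
    rintro _ ⟨t, ht, rfl⟩
    rw [SetLike.mem_coe, hmem, simple_conj_of_mem_perp M ht]
    exact simple_mem_parabolic M (hsub ht)

end Parabolic

/-! ### Geodesics of word metrics -/

namespace GenSet

variable {G : Type u} [Group G] {H : Type v} [Group H] (S : GenSet G) (T : GenSet H)

theorem wordDist_def (g h : G) : S.wordDist g h = S.cayley.dist g h := rfl

theorem wordDist_self (g : G) : S.wordDist g g = 0 := dist_self (α := S.Point) g

theorem wordDist_comm (g h : G) : S.wordDist g h = S.wordDist h g := dist_comm (α := S.Point) g h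

theorem wordDist_triangle (g h k : G) : S.wordDist g k ≤ S.wordDist g h + S.wordDist h k :=
  dist_triangle (α := S.Point) g h k

theorem dist_le_one_of_mem (g : G) {s : G} (hs : s ∈ S.carrier) :
    S.cayley.dist g (g * s) ≤ 1 := by
  by_cases h : g = g * s
  · rw [← h, SimpleGraph.dist_self]; exact zero_le_one
  · refine (SimpleGraph.dist_eq_one_iff_adj.2 ?_).le
    rw [cayley, SimpleGraph.mulCayley_adj']
    exact ⟨h, s, hs, Or.inl rfl⟩

theorem dist_le_one_iff {g h : G} : S.cayley.dist g h ≤ 1 ↔ g = h ∨ S.cayley.Adj g h := by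
  rw [← SimpleGraph.dist_eq_one_iff_adj, ← S.cayley_connected.dist_eq_zero_iff]
  omega

variable {S T} in
/-- A map that moves the endpoints of each edge to points at distance at most `1` does not increase
distances. -/
theorem dist_map_le {f : G → H}
    (hf : ∀ g, ∀ s ∈ S.carrier, T.cayley.dist (f g) (f (g * s)) ≤ 1) (g h : G) :
    T.cayley.dist (f g) (f h) ≤ S.cayley.dist g h := by
  obtain ⟨p, hp⟩ := S.cayley_connected.exists_walk_length_eq_dist g h
  rw [← hp]
  clear hp
  induction p with
  | nil => simp
  | @cons a b c hab p ih =>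
    have h1 : T.cayley.dist (f a) (f b) ≤ 1 := by
      rw [cayley, SimpleGraph.mulCayley_adj'] at hab
      obtain ⟨-, s, hs, rfl | rfl⟩ := hab
      · exact hf _ s hs
      · rw [SimpleGraph.dist_comm]; exact hf _ s hs
    have := T.cayley_connected.dist_triangle (u := f a) (v := f b) (w := f c)
    rw [SimpleGraph.Walk.length_cons]
    omega

theorem dist_mul_left (a g h : G) : S.cayley.dist (a * g) (a * h) = S.cayley.dist g h := by
  have key : ∀ a g h : G, S.cayley.dist (a * g) (a * h) ≤ S.cayley.dist g h := fun a =>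
    dist_map_le (f := fun g => a * g) fun g s hs => by
      rw [← mul_assoc]; exact S.dist_le_one_of_mem _ hs
  refine le_antisymm (key a g h) ?_
  simpa using key a⁻¹ (a * g) (a * h)

theorem wordDist_mul_left (a g h : G) : S.wordDist (a * g) (a * h) = S.wordDist g h := by
  rw [wordDist_def, dist_mul_left, wordDist_def]

theorem wordDist_self_mul (g h : G) : S.wordDist g (g * h) = S.wordDist 1 h := by
  simpa using S.wordDist_mul_left g 1 h

/-- A discrete path in the Cayley graph, whose steps have length at most `1`. -/
theorem dist_le_of_steps {γ : ℕ → G} (hγ : ∀ i, S.cayley.dist (γ i) (γ (i + 1)) ≤ 1) (i k : ℕ) :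
    S.cayley.dist (γ i) (γ (i + k)) ≤ k := by
  induction k with
  | zero => simp
  | succ k ih =>
    have := S.cayley_connected.dist_triangle (u := γ i) (v := γ (i + k)) (w := γ (i + k + 1))
    have := hγ (i + k)
    rw [← add_assoc]
    omega

theorem wordDist_le_of_steps {γ : ℕ → G} (hγ : ∀ i, S.cayley.dist (γ i) (γ (i + 1)) ≤ 1)
    (i j : ℕ) : S.wordDist (γ i) (γ j) ≤ |(i : ℝ) - j| := by
  wlog h : i ≤ j generalizing i j
  · rw [wordDist_comm, abs_sub_comm]
    exact this j i (le_of_not_ge h)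
  obtain ⟨k, rfl⟩ := Nat.exists_eq_add_of_le h
  rw [wordDist_def]
  push_cast
  rw [sub_add_cancel_left, abs_neg, Nat.abs_cast]
  exact_mod_cast S.dist_le_of_steps hγ i k

/-- N steps that cover distance N lose nothing on any subinterval, by the triangle inequality. -/
theorem wordDist_eq_of_steps {γ : ℕ → G} (hγ : ∀ i, S.cayley.dist (γ i) (γ (i + 1)) ≤ 1)
    {N : ℕ} (hN : N ≤ S.cayley.dist (γ 0) (γ N)) {i j : ℕ} (hi : i ≤ N) (hj : j ≤ N) :
    S.wordDist (γ i) (γ j) = |(i : ℝ) - j| := by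
  wlog h : i ≤ j generalizing i j
  · rw [wordDist_comm, abs_sub_comm]
    exact this hj hi (le_of_not_ge h)
  refine le_antisymm (S.wordDist_le_of_steps hγ i j) ?_
  have h1 := S.wordDist_le_of_steps hγ 0 i
  have h2 := S.wordDist_le_of_steps hγ j N
  have h3 := S.wordDist_triangle (γ 0) (γ i) (γ N)
  have h4 := S.wordDist_triangle (γ i) (γ j) (γ N)
  have h5 : (N : ℝ) ≤ S.wordDist (γ 0) (γ N) := by
    rw [wordDist_def]; exact_mod_cast hN
  have hij : (i : ℝ) ≤ j := by exact_mod_cast h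
  have hjN : (j : ℝ) ≤ N := by exact_mod_cast hj
  rw [abs_of_nonpos (by linarith)] at h2 ⊢
  rw [abs_sub_comm, Nat.cast_zero, sub_zero, Nat.abs_cast] at h1
  linarith

theorem exists_geodesic (g h : G) : ∃ γ : ℕ → G, γ 0 = g ∧ γ (S.cayley.dist g h) = h ∧
    ∀ i, S.cayley.dist (γ i) (γ (i + 1)) ≤ 1 := by
  obtain ⟨p, hp⟩ := S.cayley_connected.exists_walk_length_eq_dist g h
  refine ⟨p.getVert, p.getVert_zero, by rw [← hp, p.getVert_length], fun i => ?_⟩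
  by_cases hi : i < p.length
  · exact (SimpleGraph.dist_eq_one_iff_adj.2 (p.adj_getVert_succ hi)).le
  · rw [p.getVert_of_length_le (le_of_not_gt hi),
      p.getVert_of_length_le ((le_of_not_gt hi).trans (Nat.le_succ i)), SimpleGraph.dist_self]
    exact zero_le_one

theorem exists_wordDist_eq {g h : G} {k : ℕ} (hk : k ≤ S.cayley.dist g h) :
    ∃ x, S.cayley.dist g x = k := by
  obtain ⟨γ, h0, hN, hγ⟩ := S.exists_geodesic g h
  refine ⟨γ k, ?_⟩
  have := S.wordDist_eq_of_steps hγ (N := S.cayley.dist g h) (by rw [h0, hN]) (Nat.zero_le _) hk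
  rw [h0, wordDist_def, abs_sub_comm, Nat.cast_zero, sub_zero, Nat.abs_cast] at this
  exact_mod_cast this

theorem finite_ball (g : G) (n : ℕ) : {h | S.cayley.dist g h ≤ n}.Finite := by
  induction n with
  | zero =>
    refine (Set.finite_singleton g).subset fun h hh => ?_
    exact (S.cayley_connected.dist_eq_zero_iff.1 (Nat.le_zero.1 hh)).symm
  | succ n ih =>
    have hfin : (⋃ a ∈ {h | S.cayley.dist g h ≤ n},
        ({a} ∪ ((a * ·) '' (S.carrier : Set G) ∪ (a * ·⁻¹) '' (S.carrier : Set G)))).Finite :=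
      ih.biUnion fun a _ => (Set.finite_singleton a).union
        ((S.carrier.finite_toSet.image _).union (S.carrier.finite_toSet.image _))
    refine hfin.subset fun h hh => ?_
    obtain ⟨γ, h0, hN, hγ⟩ := S.exists_geodesic g h
    rw [Set.mem_iUnion₂]
    by_cases hd : S.cayley.dist g h ≤ n
    · exact ⟨h, hd, Or.inl rfl⟩
    have hd' : S.cayley.dist g h = n + 1 := le_antisymm hh (by omega)
    rw [hd'] at hN
    refine ⟨γ n, ?_, ?_⟩
    · have := S.dist_le_of_steps hγ 0 n
      rwa [zero_add, h0] at this
    · rcases (S.dist_le_one_iff).1 (hγ n) with h1 | h1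
      · left; rw [← hN, h1]; rfl
      · right
        rw [hN, cayley, SimpleGraph.mulCayley_adj'] at h1
        obtain ⟨-, s, hs, h2 | h2⟩ := h1
        · exact Or.inl ⟨s, hs, h2⟩
        · exact Or.inr ⟨s, hs, by simp [h2]⟩

theorem exists_dist_eq [Infinite G] (g : G) (k : ℕ) : ∃ x, S.cayley.dist g x = k := by
  obtain ⟨h, hh⟩ := (S.finite_ball g k).exists_notMem
  exact S.exists_wordDist_eq (h := h) (le_of_lt (not_le.1 hh))

/-! ### Quasigeodesics and coarse connectedness -/

/-- Rounding times down changes |s − t| by at most 1, which is why C exceeds c by 1. -/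
theorem exists_isQuasigeodesic {γ : ℕ → G} {N : ℕ} {c C : ℝ}
    (h : ∀ i ≤ N, ∀ j ≤ N, |S.wordDist (γ i) (γ j) - (|(i : ℝ) - j|)| ≤ c) (hC : c + 1 ≤ C)
    (hC1 : 1 ≤ C) : ∃ q : ℝ → G, S.IsQuasigeodesic C N q (γ 0) (γ N) ∧
      ∀ t ∈ Set.Icc (0 : ℝ) N, ∃ i ≤ N, q t = γ i := by
  have hfl : ∀ t ∈ Set.Icc (0 : ℝ) N, ⌊t⌋₊ ≤ N := fun t ht => by
    have := Nat.floor_le_floor ht.2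
    rwa [Nat.floor_natCast] at this
  refine ⟨fun t => γ ⌊t⌋₊, ⟨by simp, by simp, fun s hs t ht => ?_⟩,
    fun t ht => ⟨_, hfl t ht, rfl⟩⟩
  have h1 := abs_le.1 (h _ (hfl s hs) _ (hfl t ht))
  have hs1 := Nat.floor_le hs.1
  have hs2 := Nat.lt_floor_add_one s
  have ht1 := Nat.floor_le ht.1
  have ht2 := Nat.lt_floor_add_one t
  have h2 : |((|(⌊s⌋₊ : ℝ) - ⌊t⌋₊|) - (|s - t|))| ≤ 1 := by
    refine (abs_abs_sub_abs_le_abs_sub _ _).trans ?_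
    rw [abs_le]
    constructor <;> linarith
  rw [abs_le] at h2
  have h3 : |s - t| / C ≤ |s - t| := div_le_self (abs_nonneg _) hC1
  have h4 : |s - t| ≤ C * |s - t| := le_mul_of_one_le_left (abs_nonneg _) hC1
  constructor <;> linarith

theorem reachable_induce {A : Set G} {γ : ℕ → G}
    (hγ : ∀ i, S.cayley.dist (γ i) (γ (i + 1)) ≤ 1) (n : ℕ) (hA : ∀ i ≤ n, γ i ∈ A) :
    (S.cayley.induce A).Reachable ⟨γ 0, hA 0 (Nat.zero_le n)⟩ ⟨γ n, hA n le_rfl⟩ := by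
  induction n with
  | zero => exact SimpleGraph.Reachable.refl _
  | succ n ih =>
    refine (ih fun i hi => hA i (by omega)).trans ?_
    rcases (S.dist_le_one_iff).1 (hγ n) with h1 | h1
    · have : (⟨γ n, hA n (Nat.le_succ n)⟩ : A) = ⟨γ (n + 1), hA _ le_rfl⟩ := Subtype.ext h1
      rw [this]
    · exact SimpleGraph.Adj.reachable (G := S.cayley.induce A) h1

theorem reachable_induce_nhd {C : ℝ} {A : Set G} {g h : G} (hg : g ∈ A)
    (hgh : S.wordDist g h ≤ C) : ∃ (h1 : g ∈ S.nhd C A) (h2 : h ∈ S.nhd C A),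
      (S.cayley.induce (S.nhd C A)).Reachable ⟨g, h1⟩ ⟨h, h2⟩ := by
  obtain ⟨γ, h0, hN, hγ⟩ := S.exists_geodesic g h
  have hmem : ∀ i ≤ S.cayley.dist g h, γ i ∈ S.nhd C A := fun i hi => by
    refine ⟨g, hg, ?_⟩
    have h1 := S.wordDist_le_of_steps hγ i 0
    rw [h0, Nat.cast_zero, sub_zero, Nat.abs_cast] at h1
    have h2 : (i : ℝ) ≤ S.wordDist g h := by rw [wordDist_def]; exact_mod_cast hi
    linarith
  have := S.reachable_induce hγ _ hmem
  simp only [h0, hN] at this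
  exact ⟨_, _, this⟩

/-- Once C bounds the lengths of finitely many generators of K, geodesics from k to kt stay near K;
chains of them join all points of K, and any other point of the neighbourhood is joined to K by a
geodesic. -/
theorem exists_pathConn_nhd {K : Subgroup G} (hK : K.FG) :
    ∃ R : ℝ, ∀ C, R ≤ C → S.PathConn (S.nhd C (K : Set G)) := by
  obtain ⟨T, rfl⟩ := hK
  obtain ⟨R, hR⟩ := (T.finite_toSet.image (S.wordDist 1)).bddAbove
  refine ⟨max R 0, fun C hC => ?_⟩
  have hC0 : 0 ≤ C := (le_max_right _ _).trans hC
  have hsub : ∀ g ∈ Subgroup.closure (T : Set G),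
      g ∈ S.nhd C (Subgroup.closure (T : Set G) : Set G) :=
    fun g hg => ⟨g, hg, by rwa [wordDist_self]⟩
  have key : ∀ g (hg : g ∈ Subgroup.closure (T : Set G)) k
      (hk : k ∈ Subgroup.closure (T : Set G)),
      (S.cayley.induce (S.nhd C (Subgroup.closure (T : Set G) : Set G))).Reachable
        ⟨k, hsub k hk⟩ ⟨k * g, hsub _ (mul_mem hk hg)⟩ := by
    intro g hg
    induction hg using Subgroup.closure_induction with
    | mem t ht =>
      intro k hk
      obtain ⟨_, _, h⟩ := S.reachable_induce_nhd (C := C) (g := k) (h := k * t)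
        (A := (Subgroup.closure (T : Set G) : Set G)) hk (by
          rw [wordDist_self_mul]
          exact (hR ⟨t, ht, rfl⟩).trans ((le_max_left _ _).trans hC))
      exact h
    | one => intro k hk; simp
    | mul x y hx hy ihx ihy =>
      intro k hk
      have := (ihx k hk).trans (ihy (k * x) (mul_mem hk hx))
      simpa only [mul_assoc] using this
    | inv x hx ih =>
      intro k hk
      have := (ih (k * x⁻¹) (mul_mem hk (inv_mem hx))).symm
      simpa only [inv_mul_cancel_right] using this
  have hbase : ∀ x : S.nhd C (Subgroup.closure (T : Set G) : Set G),
      (S.cayley.induce (S.nhd C (Subgroup.closure (T : Set G) : Set G))).Reachable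
        ⟨1, hsub 1 (one_mem _)⟩ x := by
    rintro ⟨x, k, hk, hxk⟩
    obtain ⟨_, _, h⟩ := S.reachable_induce_nhd (C := C) (g := k) (h := x)
      (A := (Subgroup.closure (T : Set G) : Set G)) hk (by rwa [wordDist_comm])
    have h1 := key k hk 1 (one_mem _)
    simp only [one_mul] at h1
    exact h1.trans h
  exact
    { preconnected := fun x y => (hbase x).symm.trans (hbase y)
      nonempty := ⟨⟨1, hsub 1 (one_mem _)⟩⟩ }

/-- `H` is quasiconvex: its points are joined, near `H`, by discrete paths that are
quasigeodesics. -/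
def IsQuasiconvex (H : Subgroup G) : Prop :=
  ∃ c : ℝ, ∀ x ∈ H, ∀ y ∈ H, ∃ (N : ℕ) (γ : ℕ → G), γ 0 = x ∧ γ N = y ∧
    (∀ i ≤ N, γ i ∈ S.nhd c (H : Set G)) ∧
    ∀ i ≤ N, ∀ j ≤ N, |S.wordDist (γ i) (γ j) - (|(i : ℝ) - j|)| ≤ c

/-- A subgroup of finite index is coarsely dense, so geodesics of G serve. -/
theorem isQuasiconvex_of_finiteIndex (H : Subgroup G) [H.FiniteIndex] : S.IsQuasiconvex H := by
  have hfin : Finite (G ⧸ H) := inferInstance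
  obtain ⟨c, hc⟩ := (Set.finite_range fun x : G ⧸ H => S.wordDist 1 x.out).bddAbove
  refine ⟨max c 0, fun x _ y _ => ?_⟩
  obtain ⟨γ, h0, hN, hγ⟩ := S.exists_geodesic x y
  refine ⟨_, γ, h0, hN, fun i _ => ?_, fun i hi j hj => ?_⟩
  -- The inverse is taken so that γ i times a coset representative, a right multiplication of
  -- bounded length, lands in H.
  · obtain ⟨h, hh⟩ := QuotientGroup.mk_out_eq_mul H (γ i)⁻¹
    refine ⟨h, h.2, ?_⟩
    have h1 : (h : G) = γ i * (QuotientGroup.mk (γ i)⁻¹ : G ⧸ H).out := by rw [hh]; simp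
    rw [h1, wordDist_self_mul]
    exact (hc ⟨_, rfl⟩).trans (le_max_left _ _)
  · rw [S.wordDist_eq_of_steps hγ (by rw [h0, hN]) hi hj]
    simp

end GenSet

/-! ### Asymptotic cones of word metrics -/

section Cones

theorem coneDist_le {X : Type u} [PseudoMetricSpace X] {ω : Ultrafilter ℕ} {d : ℕ → ℝ≥0}
    {e : ℕ → X} (x y : ConeSeq ω d e) {a : ℕ → ℝ} {l : ℝ} (ha : Tendsto a ω (𝓝 l))
    (h : ∀ᶠ n in (ω : Filter ℕ), dist (x.1 n) (y.1 n) / d n ≤ a n) : dist x y ≤ l :=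
  le_of_tendsto_of_tendsto (tendsto_coneDist x y) ha h

/-- This replaces the cone by a parameter space Z before the quotient: the complement of a point is
the image of the parameters at non-zero distance from it. -/
theorem isPreconnected_compl_mk {Z : Type u} [TopologicalSpace Z] {P : Type v}
    [PseudoMetricSpace P] {f : Z → P} (hf : Continuous f) (hsurj : Function.Surjective f) {p : P}
    {U : Set Z} (hU : IsPreconnected U) (h : ∀ z, z ∈ U ↔ dist (f z) p ≠ 0) :
    IsPreconnected ({SeparationQuotient.mk p}ᶜ : Set (SeparationQuotient P)) := by
  have : ({SeparationQuotient.mk p}ᶜ : Set (SeparationQuotient P)) =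
      (fun z => SeparationQuotient.mk (f z)) '' U := by
    ext q
    obtain ⟨x, rfl⟩ := SeparationQuotient.surjective_mk q
    obtain ⟨z, rfl⟩ := hsurj x
    constructor
    · intro hz
      refine ⟨z, (h z).2 fun h0 => hz ?_, rfl⟩
      exact SeparationQuotient.mk_eq_mk.2 (Metric.inseparable_iff.2 h0)
    · rintro ⟨z', hz', hzz⟩ h0
      apply (h z').1 hz'
      exact Metric.inseparable_iff.1 (SeparationQuotient.mk_eq_mk.1 (hzz.trans h0))
  rw [this]
  exact hU.image _ (SeparationQuotient.continuous_mk.comp hf).continuousOn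

namespace GenSet

/-- The image of a generating set under an isomorphism. -/
def map {G : Type u} [Group G] {H : Type v} [Group H] (S : GenSet G) (f : G ≃* H) : GenSet H where
  carrier := S.carrier.map f.toEquiv.toEmbedding
  closure_eq := by
    have : ((S.carrier.map f.toEquiv.toEmbedding : Finset H) : Set H) =
        f.toMonoidHom '' (S.carrier : Set G) := by simp
    rw [this, ← MonoidHom.map_closure, S.closure_eq]
    exact Subgroup.map_top_of_surjective _ f.surjective

theorem dist_map {G : Type u} [Group G] {H : Type v} [Group H] (S : GenSet G) (f : G ≃* H)
    (g h : G) : (S.map f).cayley.dist (f g) (f h) = S.cayley.dist g h := by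
  apply le_antisymm
  · refine dist_map_le (S := S) (T := S.map f) (fun g s hs => ?_) g h
    rw [map_mul]
    exact (S.map f).dist_le_one_of_mem _ (by simpa [map] using hs)
  · have := dist_map_le (S := S.map f) (T := S) (f := f.symm) (fun g s hs => by
      rw [map_mul]
      refine S.dist_le_one_of_mem _ ?_
      simp only [map, Finset.mem_map] at hs
      obtain ⟨t, ht, rfl⟩ := hs
      simpa using ht) (f g) (f h)
    simpa using this

theorem wordDist_map {G : Type u} [Group G] {H : Type v} [Group H] (S : GenSet G) (f : G ≃* H)
    (g h : G) : (S.map f).wordDist (f g) (f h) = S.wordDist g h := by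
  rw [wordDist_def, dist_map, wordDist_def]

open Classical in
/-- The generating set of a product. -/
def prod {G : Type u} [Group G] {H : Type v} [Group H] (S : GenSet G) (T : GenSet H) :
    GenSet (G × H) where
  carrier := S.carrier.map ⟨fun g => (g, 1), fun _ _ h => congrArg Prod.fst h⟩ ∪
    T.carrier.map ⟨fun h => (1, h), fun _ _ h => congrArg Prod.snd h⟩
  closure_eq := by
    have h1 : (((S.carrier.map ⟨fun g => (g, 1), fun _ _ h => congrArg Prod.fst h⟩ ∪
        T.carrier.map ⟨fun h => (1, h), fun _ _ h => congrArg Prod.snd h⟩ : Finset (G × H))) :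
        Set (G × H)) = MonoidHom.inl G H '' (S.carrier : Set G) ∪
          MonoidHom.inr G H '' (T.carrier : Set H) := by
      simp only [Finset.coe_union, Finset.coe_map]; rfl
    rw [h1, Subgroup.closure_union, ← MonoidHom.map_closure, ← MonoidHom.map_closure,
      S.closure_eq, T.closure_eq, eq_top_iff]
    rintro ⟨g, h⟩ -
    have : ((g, h) : G × H) = MonoidHom.inl G H g * MonoidHom.inr G H h := by simp
    rw [this]
    exact Subgroup.mul_mem_sup ⟨g, trivial, rfl⟩ ⟨h, trivial, rfl⟩

/-! ### Word metric of a product, compared with those of the factors -/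

section Prod

variable {G : Type u} [Group G] {H : Type v} [Group H] (S : GenSet G) (T : GenSet H)

theorem mem_prod_carrier {x : G × H} (hx : x ∈ (S.prod T).carrier) :
    (x.1 ∈ S.carrier ∧ x.2 = 1) ∨ (x.1 = 1 ∧ x.2 ∈ T.carrier) := by
  simp only [prod, Finset.mem_union, Finset.mem_map] at hx
  obtain ⟨g, hg, rfl⟩ | ⟨h, hh, rfl⟩ := hx
  · exact Or.inl ⟨hg, rfl⟩
  · exact Or.inr ⟨rfl, hh⟩

theorem dist_fst_le (x y : G × H) :
    S.cayley.dist x.1 y.1 ≤ (S.prod T).cayley.dist x y := by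
  refine dist_map_le (S := S.prod T) (T := S) (f := Prod.fst) (fun g s hs => ?_) x y
  obtain ⟨h1, -⟩ | ⟨h1, -⟩ := S.mem_prod_carrier T hs
  · exact S.dist_le_one_of_mem _ h1
  · rw [Prod.fst_mul, h1, mul_one, SimpleGraph.dist_self]; exact zero_le_one

theorem dist_snd_le (x y : G × H) :
    T.cayley.dist x.2 y.2 ≤ (S.prod T).cayley.dist x y := by
  refine dist_map_le (S := S.prod T) (T := T) (f := Prod.snd) (fun g s hs => ?_) x y
  obtain ⟨-, h1⟩ | ⟨-, h1⟩ := S.mem_prod_carrier T hs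
  · rw [Prod.snd_mul, h1, mul_one, SimpleGraph.dist_self]; exact zero_le_one
  · exact T.dist_le_one_of_mem _ h1

theorem dist_prod_le (x y : G × H) :
    (S.prod T).cayley.dist x y ≤ S.cayley.dist x.1 y.1 + T.cayley.dist x.2 y.2 := by
  have h1 : (S.prod T).cayley.dist (x.1, x.2) (y.1, x.2) ≤ S.cayley.dist x.1 y.1 := by
    refine dist_map_le (S := S) (T := S.prod T) (f := fun g => (g, x.2)) (fun g s hs => ?_) x.1 y.1
    have := (S.prod T).dist_le_one_of_mem (g, x.2) (s := (s, 1))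
      (by simp only [prod, Finset.mem_union, Finset.mem_map]; exact Or.inl ⟨s, hs, rfl⟩)
    simpa using this
  have h2 : (S.prod T).cayley.dist (y.1, x.2) (y.1, y.2) ≤ T.cayley.dist x.2 y.2 := by
    refine dist_map_le (S := T) (T := S.prod T) (f := fun h => (y.1, h)) (fun g s hs => ?_) x.2 y.2
    have := (S.prod T).dist_le_one_of_mem (y.1, g) (s := (1, s))
      (by simp only [prod, Finset.mem_union, Finset.mem_map]; exact Or.inr ⟨s, hs, rfl⟩)
    simpa using this
  have := (S.prod T).cayley_connected.dist_triangle (u := (x.1, x.2)) (v := (y.1, x.2))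
    (w := (y.1, y.2))
  simp only [Prod.mk.eta] at *
  omega

end Prod

/-! ### Connectedness and non-triviality of cones -/

section

variable {G : Type u} [Group G] (S : GenSet G) {ω : Ultrafilter ℕ} {d : ℕ → ℝ≥0}
  {e : ℕ → S.Point}

/-- Geodesics from x n to y n, all parametrised by [0, 1], define a path in the cone. -/
theorem joined_coneSeq (hd : Tendsto d ω atTop) (x y : ConeSeq ω d e) : Joined x y := by
  choose γ h0 hN hγ using fun n => S.exists_geodesic (x.1 n) (y.1 n)
  set D : ℕ → ℕ := fun n => S.cayley.dist (V := G) (x.1 n) (y.1 n) with hD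
  have hDdist : ∀ n, dist (x.1 n) (y.1 n) = D n := fun n => rfl
  have hdR : Tendsto (fun n => (d n : ℝ)) ω atTop := NNReal.tendsto_coe_atTop.2 hd
  have hfl : ∀ (t : unitInterval) (n : ℕ), (⌊(t : ℝ) * D n⌋₊ : ℝ) ≤ D n := fun t n => by
    have h1 := Nat.floor_le (mul_nonneg t.2.1 (Nat.cast_nonneg (α := ℝ) (D n)))
    have h2 := mul_le_of_le_one_left (Nat.cast_nonneg (α := ℝ) (D n)) t.2.2
    linarith
  have hmem : ∀ t : unitInterval, ∃ K : ℝ, ∀ᶠ n in (ω : Filter ℕ),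
      dist (α := S.Point) (γ n ⌊(t : ℝ) * D n⌋₊) (e n) / d n ≤ K := by
    intro t
    obtain ⟨K, hK⟩ := x.2
    obtain ⟨L, hL⟩ := y.2
    refine ⟨K + L + K, ?_⟩
    filter_upwards [hK, hL] with n h1 h2
    have h3 := dist_triangle (α := S.Point) (γ n ⌊(t : ℝ) * D n⌋₊) (x.1 n) (e n)
    have h4 := (S.wordDist_le_of_steps (hγ n) ⌊(t : ℝ) * D n⌋₊ 0)
    rw [h0, Nat.cast_zero, sub_zero, Nat.abs_cast] at h4
    have h5 := dist_triangle_right (x.1 n) (y.1 n) (e n)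
    have h6 := hfl t n
    have h8 := hDdist n
    have h7 : dist (α := S.Point) (γ n ⌊(t : ℝ) * D n⌋₊) (x.1 n) ≤ ⌊(t : ℝ) * D n⌋₊ := h4
    calc dist (α := S.Point) (γ n ⌊(t : ℝ) * D n⌋₊) (e n) / d n
        ≤ (dist (x.1 n) (e n) + dist (y.1 n) (e n) + dist (x.1 n) (e n)) / d n := by
          gcongr; linarith
      _ ≤ K + L + K := by rw [add_div, add_div]; gcongr
  let p : unitInterval → ConeSeq ω d e := fun t => ⟨fun n => γ n ⌊(t : ℝ) * D n⌋₊, hmem t⟩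
  have hp : ∀ s t : unitInterval, dist (p s) (p t) ≤ dist x y * dist s t := by
    intro s t
    -- Rounding the parameter costs 1 in the word metric, hence 1 / d n after rescaling, which
    -- vanishes in the limit.
    have hlim : Tendsto (fun n => dist (x.1 n) (y.1 n) / (d n : ℝ) * dist s t + 1 / (d n : ℝ)) ω
        (𝓝 (dist x y * dist s t + 0)) :=
      ((tendsto_coneDist x y).mul_const _).add (by
        simp only [one_div]
        exact tendsto_inv_atTop_zero.comp hdR)
    rw [add_zero] at hlim
    refine coneDist_le _ _ hlim (Eventually.of_forall fun n => ?_)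
    have h1 := S.wordDist_le_of_steps (hγ n) ⌊(s : ℝ) * D n⌋₊ ⌊(t : ℝ) * D n⌋₊
    have hs1 := Nat.floor_le (mul_nonneg s.2.1 (Nat.cast_nonneg (α := ℝ) (D n)))
    have hs2 := Nat.lt_floor_add_one ((s : ℝ) * D n)
    have ht1 := Nat.floor_le (mul_nonneg t.2.1 (Nat.cast_nonneg (α := ℝ) (D n)))
    have ht2 := Nat.lt_floor_add_one ((t : ℝ) * D n)
    have h2 : |(⌊(s : ℝ) * D n⌋₊ : ℝ) - ⌊(t : ℝ) * D n⌋₊| ≤ (D n : ℝ) * dist s t + 1 := by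
      have h3 : (D n : ℝ) * dist s t = |(s : ℝ) * D n - t * D n| := by
        rw [Subtype.dist_eq, Real.dist_eq, ← sub_mul, abs_mul, Nat.abs_cast, mul_comm]
      rw [h3]
      have h4 := abs_le.1 (le_refl |(s : ℝ) * D n - t * D n|)
      rw [abs_le]
      constructor <;> linarith
    have h3 : dist ((p s).1 n) ((p t).1 n) ≤ (D n : ℝ) * dist s t + 1 := h1.trans h2
    rw [hDdist, div_mul_eq_mul_div, ← add_div]
    gcongr
  have hcont : Continuous p := (LipschitzWith.of_dist_le' hp).continuous
  refine ⟨⟨⟨p, hcont⟩, ?_, ?_⟩⟩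
  · refine Subtype.ext (funext fun n => ?_)
    change γ n ⌊((0 : unitInterval) : ℝ) * D n⌋₊ = _
    rw [Set.Icc.coe_zero, zero_mul, Nat.floor_zero, h0]
  · refine Subtype.ext (funext fun n => ?_)
    change γ n ⌊((1 : unitInterval) : ℝ) * D n⌋₊ = _
    rw [Set.Icc.coe_one, one_mul, Nat.floor_natCast, hN]

theorem preconnectedSpace_coneSeq (hd : Tendsto d ω atTop) :
    PreconnectedSpace (ConeSeq ω d e) := by
  have : PathConnectedSpace (ConeSeq ω d e) :=
    { nonempty := ⟨⟨e, 0, by simp⟩⟩, joined := S.joined_coneSeq hd }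
  infer_instance

/-- An infinite Cayley graph has points at every distance from x n; at distance ⌈d n⌉ they give a
cone point at distance at least 1. -/
theorem exists_coneSeq_dist_ne_zero [Infinite G] (hd : Tendsto d ω atTop) (x : ConeSeq ω d e) :
    ∃ y : ConeSeq ω d e, dist y x ≠ 0 := by
  obtain ⟨y, hy⟩ : ∃ y : ℕ → S.Point, ∀ n, S.cayley.dist (V := G) (x.1 n) (y n) = ⌈d n⌉₊ :=
    ⟨_, fun n => (S.exists_dist_eq (x.1 n) ⌈d n⌉₊).choose_spec⟩
  have hd1 : ∀ᶠ n in (ω : Filter ℕ), 1 ≤ d n := hd.eventually_ge_atTop 1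
  have hdist : ∀ n, dist (α := S.Point) (y n) (x.1 n) = (⌈d n⌉₊ : ℝ) := fun n =>
    (dist_comm (α := S.Point) _ _).trans (congrArg Nat.cast (hy n))
  obtain ⟨K, hK⟩ := x.2
  have hmem : ∀ᶠ n in (ω : Filter ℕ), dist (α := S.Point) (y n) (e n) / d n ≤ 2 + K := by
    filter_upwards [hK, hd1] with n h1 h2
    have h2' : (1 : ℝ) ≤ d n := by exact_mod_cast h2
    have h3 : (⌈d n⌉₊ : ℝ) ≤ 2 * d n := by
      have : ((⌈d n⌉₊ : ℝ≥0) : ℝ) < ((d n + 1 : ℝ≥0) : ℝ) :=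
        NNReal.coe_lt_coe.2 (Nat.ceil_lt_add_one zero_le)
      push_cast at this
      linarith
    have h4 := dist_triangle (α := S.Point) (y n) (x.1 n) (e n)
    rw [hdist] at h4
    calc dist (α := S.Point) (y n) (e n) / d n ≤ (2 * d n + dist (x.1 n) (e n)) / d n := by
          gcongr; linarith
      _ ≤ 2 + K := by
          rw [add_div, mul_div_assoc, div_self (by positivity), mul_one]; gcongr
  let z : ConeSeq ω d e := ⟨y, _, hmem⟩
  refine ⟨z, ?_⟩
  have : (1 : ℝ) ≤ dist z x := by
    refine ge_of_tendsto (tendsto_coneDist z x) ?_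
    filter_upwards [hd1] with n h2
    have h2' : (0 : ℝ) < d n := lt_of_lt_of_le one_pos (by exact_mod_cast h2)
    rw [one_le_div h2']
    refine le_trans ?_ (hdist n).ge
    exact_mod_cast Nat.le_ceil (d n)
  linarith

end

end GenSet

theorem IsWide.of_mulEquiv {G : Type u} [Group G] {H : Type v} [Group H] (f : G ≃* H)
    (hG : IsWide G) : IsWide H := by
  obtain ⟨S, hS⟩ := hG
  refine ⟨S.map f, fun ω d e hω hd p => ?_⟩
  rw [IsCutPoint, not_not]
  obtain ⟨p, rfl⟩ := SeparationQuotient.surjective_mk p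
  have hdist : ∀ a b : G, dist (α := (S.map f).Point) (f a) (f b) = dist (α := S.Point) a b :=
    S.wordDist_map f
  have hdist' : ∀ a b : H, dist (α := S.Point) (f.symm a) (f.symm b) =
      dist (α := (S.map f).Point) a b := fun a b => by
    rw [← hdist, f.apply_symm_apply, f.apply_symm_apply]
  have hdist'' : ∀ (a : G) (b : H), dist (α := (S.map f).Point) (f a) b =
      dist (α := S.Point) a (f.symm b) := fun a b => by
    rw [← hdist', f.symm_apply_apply]
  let e' : ℕ → S.Point := fun n => f.symm (e n)
  let F : ConeSeq ω d e' → ConeSeq ω d e := fun x => ⟨fun n => f (x.1 n), by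
    obtain ⟨K, hK⟩ := x.2
    refine ⟨K, hK.mono fun n hn => ?_⟩
    exact (congrArg (· / (d n : ℝ)) (hdist'' (x.1 n) (e n))).le.trans hn⟩
  have hF : ∀ x y, dist (F x) (F y) = dist x y := fun x y => by
    refine tendsto_nhds_unique (tendsto_coneDist (F x) (F y)) ?_
    exact (tendsto_coneDist x y).congr fun n => congrArg (· / (d n : ℝ)) (hdist _ _).symm
  have hFs : Function.Surjective F := fun y => by
    obtain ⟨K, hK⟩ := y.2
    refine ⟨⟨fun n => f.symm (y.1 n), K, hK.mono fun n hn => ?_⟩, ?_⟩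
    · exact (congrArg (· / (d n : ℝ)) (hdist' _ _)).le.trans hn
    · exact Subtype.ext (funext fun n => f.apply_symm_apply _)
  obtain ⟨q, rfl⟩ := hFs p
  refine isPreconnected_compl_mk (f := F) (U := {x | dist x q ≠ 0})
    (Isometry.of_dist_eq hF).continuous hFs ?_ fun z => by rw [hF]; rfl
  rw [← SeparationQuotient.isInducing_mk.isPreconnected_image]
  have := hS ω d e' hω hd (SeparationQuotient.mk q)
  rw [IsCutPoint, not_not] at this
  convert this using 1
  ext z
  obtain ⟨z, rfl⟩ := SeparationQuotient.surjective_mk z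
  constructor
  · rintro ⟨z', hz', hzz⟩ h0
    apply hz'
    exact Metric.inseparable_iff.1 (SeparationQuotient.mk_eq_mk.1 (hzz.trans h0))
  · intro hz
    refine ⟨z, fun h0 => hz ?_, rfl⟩
    exact SeparationQuotient.mk_eq_mk.2 (Metric.inseparable_iff.2 h0)

/-- A product of two infinite finitely generated groups is wide. -/
theorem isWide_prod {G : Type u} [Group G] {H : Type v} [Group H] [Infinite G] [Infinite H]
    (S : GenSet G) (T : GenSet H) : IsWide (G × H) := by
  refine ⟨S.prod T, fun ω d e hω hd p => ?_⟩
  rw [IsCutPoint, not_not]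
  obtain ⟨p, rfl⟩ := SeparationQuotient.surjective_mk p
  let e₁ : ℕ → S.Point := fun n => (show G × H from e n).1
  let e₂ : ℕ → T.Point := fun n => (show G × H from e n).2
  have hfst : ∀ x y : G × H, dist (α := S.Point) x.1 y.1 ≤ dist (α := (S.prod T).Point) x y :=
    fun x y => Nat.cast_le.2 (S.dist_fst_le T x y)
  have hsnd : ∀ x y : G × H, dist (α := T.Point) x.2 y.2 ≤ dist (α := (S.prod T).Point) x y :=
    fun x y => Nat.cast_le.2 (S.dist_snd_le T x y)
  have hprod : ∀ x y : G × H, dist (α := (S.prod T).Point) x y ≤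
      dist (α := S.Point) x.1 y.1 + dist (α := T.Point) x.2 y.2 := fun x y => by
    have := (Nat.cast_le (α := ℝ)).2 (S.dist_prod_le T x y)
    push_cast at this
    exact this
  -- F maps the product of the cones of the factors onto the cone of the product, and distorts
  -- distances by bounded factors only.
  let F : ConeSeq ω d e₁ × ConeSeq ω d e₂ → ConeSeq ω d e := fun x =>
    ⟨fun n => (show G × H from (x.1.1 n, x.2.1 n)), by
      obtain ⟨K, hK⟩ := x.1.2
      obtain ⟨L, hL⟩ := x.2.2
      refine ⟨K + L, ?_⟩
      filter_upwards [hK, hL] with n h1 h2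
      refine le_trans ?_ (add_le_add h1 h2)
      rw [← add_div]
      exact div_le_div_of_nonneg_right (hprod (x.1.1 n, x.2.1 n) (e n)) (NNReal.coe_nonneg _)⟩
  have hF : ∀ x y, dist (F x) (F y) ≤ dist x.1 y.1 + dist x.2 y.2 := fun x y => by
    refine coneDist_le _ _ ((tendsto_coneDist x.1 y.1).add (tendsto_coneDist x.2 y.2))
      (Eventually.of_forall fun n => ?_)
    rw [← add_div]
    exact div_le_div_of_nonneg_right (hprod (x.1.1 n, x.2.1 n) (y.1.1 n, y.2.1 n))
      (NNReal.coe_nonneg _)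
  have hF1 : ∀ x y, dist x.1 y.1 ≤ dist (F x) (F y) := fun x y =>
    coneDist_le _ _ (tendsto_coneDist (F x) (F y)) (Eventually.of_forall fun n =>
      div_le_div_of_nonneg_right (hfst (x.1.1 n, x.2.1 n) (y.1.1 n, y.2.1 n)) (NNReal.coe_nonneg _))
  have hF2 : ∀ x y, dist x.2 y.2 ≤ dist (F x) (F y) := fun x y =>
    coneDist_le _ _ (tendsto_coneDist (F x) (F y)) (Eventually.of_forall fun n =>
      div_le_div_of_nonneg_right (hsnd (x.1.1 n, x.2.1 n) (y.1.1 n, y.2.1 n)) (NNReal.coe_nonneg _))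
  have hFc : Continuous F := by
    refine (LipschitzWith.of_dist_le' (K := 2) fun x y => (hF x y).trans ?_).continuous
    rw [Prod.dist_eq, two_mul]
    exact add_le_add (le_max_left _ _) (le_max_right _ _)
  have hFs : Function.Surjective F := fun y => by
    obtain ⟨K, hK⟩ := y.2
    refine ⟨(⟨fun n => (show G × H from y.1 n).1, K, hK.mono fun n hn => ?_⟩,
      ⟨fun n => (show G × H from y.1 n).2, K, hK.mono fun n hn => ?_⟩), rfl⟩
    · exact (div_le_div_of_nonneg_right (hfst (y.1 n) (e n)) (NNReal.coe_nonneg _)).trans hn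
    · exact (div_le_div_of_nonneg_right (hsnd (y.1 n) (e n)) (NNReal.coe_nonneg _)).trans hn
  obtain ⟨⟨a, b⟩, rfl⟩ := hFs p
  have := S.preconnectedSpace_coneSeq (e := e₁) hd
  have := T.preconnectedSpace_coneSeq (e := e₂) hd
  obtain ⟨a', ha'⟩ := S.exists_coneSeq_dist_ne_zero hd a
  obtain ⟨b', hb'⟩ := T.exists_coneSeq_dist_ne_zero hd b
  refine isPreconnected_compl_mk (f := F) (U := {x | dist x.1 a ≠ 0 ∨ dist x.2 b ≠ 0}) hFc hFs ?_
    fun z => ?_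
  · have hv : ∀ x : ConeSeq ω d e₁, IsPreconnected ((fun y => (x, y)) ''
        (Set.univ : Set (ConeSeq ω d e₂))) := fun x =>
      isPreconnected_univ.image _ (by fun_prop)
    have hh : ∀ y : ConeSeq ω d e₂, IsPreconnected ((fun x => (x, y)) ''
        (Set.univ : Set (ConeSeq ω d e₁))) := fun y =>
      isPreconnected_univ.image _ (by fun_prop)
    -- A point off (a, b) has a coordinate differing from a or b. The slice through it with that
    -- coordinate fixed avoids (a, b), and meets a perpendicular slice through (a', b') that avoids
    -- it too.
    refine isPreconnected_of_forall (a', b') ?_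
    rintro ⟨x, y⟩ (hx | hy)
    · refine ⟨(fun y => (x, y)) '' Set.univ ∪ (fun x => (x, b')) '' Set.univ, ?_,
        Or.inr ⟨a', trivial, rfl⟩, Or.inl ⟨y, trivial, rfl⟩,
        (hv x).union (x, b') ⟨b', trivial, rfl⟩ ⟨x, trivial, rfl⟩ (hh b')⟩
      rintro _ (⟨y, -, rfl⟩ | ⟨x, -, rfl⟩)
      exacts [Or.inl hx, Or.inr hb']
    · refine ⟨(fun y => (a', y)) '' Set.univ ∪ (fun x => (x, y)) '' Set.univ, ?_,
        Or.inl ⟨b', trivial, rfl⟩, Or.inr ⟨x, trivial, rfl⟩,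
        (hv a').union (a', y) ⟨y, trivial, rfl⟩ ⟨a', trivial, rfl⟩ (hh y)⟩
      rintro _ (⟨y, -, rfl⟩ | ⟨x, -, rfl⟩)
      exacts [Or.inl ha', Or.inr hy]
  · constructor
    · rintro (h | h) h0
      · exact h (le_antisymm ((hF1 z (a, b)).trans h0.le) dist_nonneg)
      · exact h (le_antisymm ((hF2 z (a, b)).trans h0.le) dist_nonneg)
    · intro h
      by_contra hcon
      simp only [Set.mem_ofPred_eq, not_or, not_not] at hcon
      refine h (le_antisymm ((hF z (a, b)).trans ?_) dist_nonneg)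
      rw [hcon.1, hcon.2, add_zero]

end Cones

/-! ### Invariance and monotonicity of thickness -/

section Thickness

theorem closure_iUnion_subgroup {G : Type u} [Group G] (ℋ : Set (Subgroup G)) :
    Subgroup.closure (⋃ H ∈ ℋ, (H : Set G)) = ⨆ H ∈ ℋ, H := by
  simp only [Subgroup.closure_iUnion, Subgroup.closure_eq]

namespace GenSet

variable {G : Type u} [Group G] {H : Type v} [Group H] (S : GenSet G) (f : G ≃* H)

theorem nhd_map (C : ℝ) (A : Set G) : (S.map f).nhd C (f '' A) = f '' S.nhd C A := by
  ext h
  constructor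
  · rintro ⟨_, ⟨a, ha, rfl⟩, hh⟩
    refine ⟨f.symm h, ⟨a, ha, ?_⟩, f.apply_symm_apply h⟩
    rwa [← S.wordDist_map f, f.apply_symm_apply]
  · rintro ⟨g, ⟨a, ha, hg⟩, rfl⟩
    exact ⟨f a, ⟨a, ha, rfl⟩, by rwa [wordDist_map]⟩

theorem adj_map {g h : G} (hgh : S.cayley.Adj g h) : (S.map f).cayley.Adj (f g) (f h) := by
  rwa [← SimpleGraph.dist_eq_one_iff_adj, dist_map, SimpleGraph.dist_eq_one_iff_adj]

theorem PathConn.map {S : GenSet G} {A : Set G} (hA : S.PathConn A) :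
    (S.map f).PathConn (f '' A) := by
  refine SimpleGraph.Connected.map (G := S.cayley.induce A)
    ⟨fun a => ⟨f a.1, a.1, a.2, rfl⟩, fun h => S.adj_map f h⟩ ?_ hA
  rintro ⟨_, a, ha, rfl⟩
  exact ⟨⟨a, ha⟩, rfl⟩

end GenSet

theorem ThickOfOrderAtMost.of_mulEquiv (n : ℕ) {G : Type u} [Group G] {H : Type v} [Group H]
    (f : G ≃* H) (hG : ThickOfOrderAtMost n G) : ThickOfOrderAtMost n H := by
  induction n generalizing G H with
  | zero => exact IsWide.of_mulEquiv f hG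
  | succ n ih =>
    obtain ⟨S, ℋ, C, hfin, hC, hthick, hindex, hchain, hquasi⟩ := hG
    refine ⟨S.map f, Subgroup.map f.toMonoidHom '' ℋ, C, hfin.image _, hC, ?_, ?_, ?_, ?_⟩
    · rintro _ ⟨K, hK, rfl⟩
      exact ih (f.subgroupMap K) (hthick K hK)
    · rw [closure_iUnion_subgroup] at hindex ⊢
      have : ⨆ K ∈ Subgroup.map f.toMonoidHom '' ℋ, K =
          (⨆ K ∈ ℋ, K).map f.toMonoidHom := by
        rw [iSup_image]
        simp only [Subgroup.map_iSup]
      rw [this]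
      exact ⟨by rw [Subgroup.index_map_of_bijective f.bijective]; exact hindex.index_ne_zero⟩
    · rintro _ ⟨K, hK, rfl⟩ _ ⟨L, hL, rfl⟩
      refine (hchain K hK L hL).lift (Subgroup.map f.toMonoidHom) ?_
      rintro K L ⟨hK, hL, hinf, hconn⟩
      have hKL : K.map f.toMonoidHom ⊓ L.map f.toMonoidHom = (K ⊓ L).map f.toMonoidHom :=
        (Subgroup.map_inf K L _ f.injective).symm
      refine ⟨⟨K, hK, rfl⟩, ⟨L, hL, rfl⟩, ?_, ?_⟩
      · rw [hKL]
        exact (f.subgroupMap (K ⊓ L)).toEquiv.infinite_iff.1 hinf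
      · rw [hKL, Subgroup.coe_map]
        have := hconn.map f
        rw [← GenSet.nhd_map] at this
        exact this
    · rintro _ ⟨K, hK, rfl⟩ _ ⟨x, hx, rfl⟩ _ ⟨y, hy, rfl⟩
      obtain ⟨L, q, hL, ⟨h0, h1, hq⟩, hnear⟩ := hquasi K hK x hx y hy
      refine ⟨L, fun t => f (q t), hL, ⟨congrArg f h0, congrArg f h1, fun s hs t ht => ?_⟩,
        fun t ht => ?_⟩
      · rw [GenSet.wordDist_map]; exact hq s hs t ht
      · have : f (q t) ∈ f '' S.nhd C (K : Set G) := ⟨_, hnear t ht, rfl⟩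
        rw [← GenSet.nhd_map] at this
        exact this

theorem ThickOfOrderAtMost.exists_genSet {n : ℕ} {G : Type u} [Group G]
    (hG : ThickOfOrderAtMost n G) : Nonempty (GenSet G) := by
  cases n with
  | zero => obtain ⟨S, -⟩ := hG; exact ⟨S⟩
  | succ n => obtain ⟨S, -⟩ := hG; exact ⟨S⟩

/-- All thickness of positive order is obtained here, from the family {H, K}. When H = K the chain
condition is void, and no intersection has to be controlled. -/
theorem ThickOfOrderAtMost.of_pair {n : ℕ} {G : Type u} [Group G] (S : GenSet G)
    {H K : Subgroup G} (hH : ThickOfOrderAtMost n H) (hK : ThickOfOrderAtMost n K)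
    (hindex : (H ⊔ K).FiniteIndex)
    (hmeet : H = K ∨ (Infinite ↥(H ⊓ K) ∧ (H ⊓ K).FG))
    (hHq : S.IsQuasiconvex H) (hKq : S.IsQuasiconvex K) : ThickOfOrderAtMost (n + 1) G := by
  obtain ⟨c₁, h₁⟩ := hHq
  obtain ⟨c₂, h₂⟩ := hKq
  obtain ⟨R, hR⟩ : ∃ R : ℝ, H = K ∨ (Infinite ↥(H ⊓ K) ∧
      ∀ C, R ≤ C → S.PathConn (S.nhd C ((H ⊓ K : Subgroup G) : Set G))) := by
    rcases hmeet with h | ⟨hi, hf⟩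
    · exact ⟨0, Or.inl h⟩
    · obtain ⟨R, hR⟩ := S.exists_pathConn_nhd hf
      exact ⟨R, Or.inr ⟨hi, hR⟩⟩
  obtain ⟨C, hC1, hCc₁, hCc₂, hCR, hC₁, hC₂⟩ : ∃ C : ℝ, 1 ≤ C ∧ c₁ + 1 ≤ C ∧ c₂ + 1 ≤ C ∧ R ≤ C ∧
      c₁ ≤ C ∧ c₂ ≤ C := by
    have h1 := abs_nonneg c₁
    have h2 := abs_nonneg c₂
    have h3 := abs_nonneg R
    have h4 := le_abs_self c₁
    have h5 := le_abs_self c₂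
    have h6 := le_abs_self R
    refine ⟨|c₁| + |c₂| + |R| + 1, ?_, ?_, ?_, ?_, ?_, ?_⟩ <;> linarith
  refine ⟨S, {H, K}, C, Set.toFinite _, hC1, ?_, ?_, ?_, ?_⟩
  · rintro L (rfl | rfl)
    exacts [hH, hK]
  · rw [closure_iUnion_subgroup, iSup_pair]
    exact hindex
  · rcases hR with rfl | ⟨hi, hR⟩
    · rintro L (rfl | rfl) L' (rfl | rfl) <;> exact Relation.ReflTransGen.refl
    · have hHK : ThicklyMeet S C {H, K} H K := ⟨Or.inl rfl, Or.inr rfl, hi, hR C hCR⟩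
      have hKH : ThicklyMeet S C {H, K} K H :=
        ⟨Or.inr rfl, Or.inl rfl, by rwa [inf_comm], by rw [inf_comm]; exact hR C hCR⟩
      rintro L (rfl | rfl) L' (rfl | rfl)
      · exact Relation.ReflTransGen.refl
      · exact Relation.ReflTransGen.single hHK
      · exact Relation.ReflTransGen.single hKH
      · exact Relation.ReflTransGen.refl
  · have key : ∀ (L : Subgroup G) (c : ℝ), c + 1 ≤ C → c ≤ C →
        (∀ x ∈ L, ∀ y ∈ L, ∃ (N : ℕ) (γ : ℕ → G), γ 0 = x ∧ γ N = y ∧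
          (∀ i ≤ N, γ i ∈ S.nhd c (L : Set G)) ∧
          ∀ i ≤ N, ∀ j ≤ N, |S.wordDist (γ i) (γ j) - (|(i : ℝ) - j|)| ≤ c) →
        ∀ x ∈ L, ∀ y ∈ L, ∃ (N : ℝ) (q : ℝ → G), 0 ≤ N ∧ S.IsQuasigeodesic C N q x y ∧
          ∀ t ∈ Set.Icc 0 N, q t ∈ S.nhd C (L : Set G) := by
      intro L c hc hc' h x hx y hy
      obtain ⟨N, γ, rfl, rfl, hnear, hγ⟩ := h x hx y hy
      obtain ⟨q, hq, hqγ⟩ := S.exists_isQuasigeodesic hγ hc hC1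
      refine ⟨N, q, Nat.cast_nonneg N, hq, fun t ht => ?_⟩
      obtain ⟨i, hi, hqi⟩ := hqγ t ht
      obtain ⟨a, ha, hia⟩ := hnear i hi
      exact ⟨a, ha, by rw [hqi]; exact hia.trans hc'⟩
    rintro L (rfl | rfl)
    exacts [key _ c₁ hCc₁ hC₁ h₁, key _ c₂ hCc₂ hC₂ h₂]

/-- The pair is H with itself. One order is spent, which avoids showing that wideness passes from H
to G. -/
theorem ThickOfOrderAtMost.of_finiteIndex {n : ℕ} {G : Type u} [Group G] (S : GenSet G)
    {H : Subgroup G} [H.FiniteIndex] (hH : ThickOfOrderAtMost n H) :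
    ThickOfOrderAtMost (n + 1) G :=
  .of_pair S hH hH (by rw [sup_idem]; infer_instance) (Or.inl rfl)
    (S.isQuasiconvex_of_finiteIndex H) (S.isQuasiconvex_of_finiteIndex H)

theorem ThickOfOrderAtMost.mono {m n : ℕ} (hmn : m ≤ n) {G : Type u} [Group G]
    (hG : ThickOfOrderAtMost m G) : ThickOfOrderAtMost n G := by
  induction hmn with
  | refl => exact hG
  | step _ ih =>
    obtain ⟨S⟩ := ih.exists_genSet
    exact .of_finiteIndex S (H := ⊤) (ih.of_mulEquiv _ Subgroup.topEquiv.symm)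

end Thickness

/-! ### Word metrics of Coxeter groups -/

section CoxeterThick

variable {B : Type u} (M : CoxeterMatrix B)

/-- The generating set of the simple reflections. -/
def simpleGenSet [Finite B] : GenSet M.Group where
  carrier := (Set.finite_range M.simple).toFinset
  closure_eq := by rw [Set.Finite.coe_toFinset, closure_range_simple]

variable [Finite B]

theorem length_le_dist (g h : M.Group) :
    M.toCoxeterSystem.length (g⁻¹ * h) ≤ (simpleGenSet M).cayley.dist g h := by
  obtain ⟨p, hp⟩ := (simpleGenSet M).cayley_connected.exists_walk_length_eq_dist g h
  rw [← hp]
  clear hp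
  induction p with
  | nil => simp
  | @cons a b c hab p ih =>
    have h1 : M.toCoxeterSystem.length (a⁻¹ * b) ≤ 1 := by
      rw [GenSet.cayley, SimpleGraph.mulCayley_adj'] at hab
      obtain ⟨-, s, hs, rfl | rfl⟩ := hab <;>
      · obtain ⟨i, rfl⟩ := (Set.Finite.mem_toFinset _).1 hs
        have := M.toCoxeterSystem.length_simple i
        rw [M.toCoxeterSystem_simple] at this
        simp [this]
    have h2 := M.toCoxeterSystem.length_mul_le (a⁻¹ * b) (b⁻¹ * c)
    rw [mul_assoc, mul_inv_cancel_left] at h2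
    rw [SimpleGraph.Walk.length_cons]
    omega

/-- A reduced word of x⁻¹y uses letters of J only, so it traces a geodesic inside W_J. -/
theorem isQuasiconvex_parabolic (J : Set B) : (simpleGenSet M).IsQuasiconvex (parabolic M J) := by
  refine ⟨0, fun x hx y hy => ?_⟩
  obtain ⟨ω, hω, hprod, hlen⟩ := exists_word_of_mem_parabolic M _ (mul_mem (inv_mem hx) hy)
  let γ : ℕ → M.Group := fun i => x * M.toCoxeterSystem.wordProd (ω.take i)
  have hstep : ∀ i, (simpleGenSet M).cayley.dist (γ i) (γ (i + 1)) ≤ 1 := fun i => by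
    simp only [γ, GenSet.dist_mul_left]
    by_cases hi : i < ω.length
    · rw [List.take_succ_eq_append_getElem hi, M.toCoxeterSystem.wordProd_append,
        M.toCoxeterSystem.wordProd_singleton, M.toCoxeterSystem_simple]
      exact (simpleGenSet M).dist_le_one_of_mem _
        ((Set.Finite.mem_toFinset _).2 (Set.mem_range_self _))
    · rw [List.take_of_length_le (by omega), List.take_of_length_le (by omega),
        SimpleGraph.dist_self]
      exact zero_le_one
  have h0 : γ 0 = x := by simp [γ]
  have hN : γ ω.length = y := by simp [γ, hprod]
  refine ⟨ω.length, γ, h0, hN, fun i _ => ⟨γ i, ?_, by rw [GenSet.wordDist_self]⟩,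
    fun i hi j hj => ?_⟩
  · refine mul_mem hx ?_
    rw [CoxeterSystem.wordProd]
    refine Subgroup.list_prod_mem _ fun g hg => ?_
    obtain ⟨j, hj, rfl⟩ := List.mem_map.1 hg
    rw [M.toCoxeterSystem_simple]
    exact simple_mem_parabolic M (hω j (List.mem_of_mem_take hj))
  · rw [(simpleGenSet M).wordDist_eq_of_steps hstep _ hi hj, sub_self, abs_zero]
    rw [h0, hN, hlen]
    exact length_le_dist M x y

/-- Left translation by a is an isometry and right translation by a⁻¹ moves every point by the
length of a⁻¹, so conjugation changes distances by a bounded amount. -/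
theorem GenSet.IsQuasiconvex.map_conj {G : Type u} [Group G] {S : GenSet G}
    {H : Subgroup G} (hH : S.IsQuasiconvex H) (a : G) :
    S.IsQuasiconvex (H.map (MulAut.conj a).toMonoidHom) := by
  obtain ⟨c, hc⟩ := hH
  have hconj : ∀ g h : G, |S.wordDist (a * g * a⁻¹) (a * h * a⁻¹) - S.wordDist g h| ≤
      2 * S.wordDist 1 a⁻¹ := fun g h => by
    rw [mul_assoc, mul_assoc, S.wordDist_mul_left]
    have h1 := S.wordDist_self_mul g a⁻¹
    have h2 := S.wordDist_self_mul h a⁻¹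
    have h3 := S.wordDist_triangle g (g * a⁻¹) h
    have h4 := S.wordDist_triangle (g * a⁻¹) (h * a⁻¹) h
    have h5 := S.wordDist_triangle (g * a⁻¹) g (h * a⁻¹)
    have h6 := S.wordDist_triangle g h (h * a⁻¹)
    rw [S.wordDist_comm (h * a⁻¹) h] at h4
    rw [S.wordDist_comm (g * a⁻¹) g] at h5
    rw [abs_le]
    constructor <;> linarith
  refine ⟨c + 2 * S.wordDist 1 a⁻¹, ?_⟩
  rintro _ ⟨x, hx, rfl⟩ _ ⟨y, hy, rfl⟩
  obtain ⟨N, γ, rfl, rfl, hnear, hγ⟩ := hc x hx y hy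
  refine ⟨N, fun i => a * γ i * a⁻¹, rfl, rfl, fun i hi => ?_, fun i hi j hj => ?_⟩
  · obtain ⟨b, hb, hib⟩ := hnear i hi
    refine ⟨_, ⟨b, hb, rfl⟩, ?_⟩
    have := (abs_le.1 (hconj (γ i) b)).2
    change S.wordDist (a * γ i * a⁻¹) (a * b * a⁻¹) ≤ _
    linarith
  · have h1 := abs_le.1 (hconj (γ i) (γ j))
    have h2 := abs_le.1 (hγ i hi j hj)
    rw [abs_le]
    constructor <;> linarith [h1.1, h1.2, h2.1, h2.2]

end CoxeterThick

/-! ### Coxeter groups with positive semidefinite form -/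

/-- A ball of radius 1/2 holds at most one of the points, and finitely many such balls cover a
compact ball. -/
theorem finite_of_separated {ι : Type u} {E : Type v} [PseudoMetricSpace E] [ProperSpace E]
    {f : ι → E} (hf : ∀ i j, i ≠ j → 1 ≤ dist (f i) (f j)) (c : E) (r : ℝ) :
    {i | dist (f i) c ≤ r}.Finite := by
  obtain ⟨t, -, htf, ht⟩ := (isCompact_closedBall c r).finite_cover_balls (e := 1 / 2) (by norm_num)
  have : {i | dist (f i) c ≤ r} ⊆ ⋃ x ∈ t, {i | dist (f i) x < 1 / 2} := fun i hi => by
    have := ht (Metric.mem_closedBall.2 hi)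
    simpa using this
  refine (htf.biUnion fun x _ => Set.Subsingleton.finite ?_).subset this
  intro i hi j hj
  by_contra hij
  have h1 := hf i j hij
  have h2 := dist_triangle_right (f i) (f j) x
  rw [Set.mem_ofPred_eq] at hi hj
  linarith

section Affine

variable {B : Type u} (M : CoxeterMatrix B)

theorem exists_gram [Finite B] (h : (formMatrix M).PosSemidef) :
    ∃ (m : ℕ) (L : (B →₀ ℝ) →ₗ[ℝ] EuclideanSpace ℝ (Fin m)),
      ∀ x y, inner ℝ (L x) (L y) = form M x y := by
  obtain ⟨m, v, hv⟩ := Matrix.posSemidef_iff_eq_sum_vecMulVec.1 h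
  refine ⟨m, Finsupp.linearCombination ℝ fun i => WithLp.toLp 2 fun k => v k i, fun x y => ?_⟩
  set L : (B →₀ ℝ) →ₗ[ℝ] EuclideanSpace ℝ (Fin m) :=
    Finsupp.linearCombination ℝ fun i => WithLp.toLp 2 fun k => v k i with hL
  have : (innerₗ (EuclideanSpace ℝ (Fin m))).compl₁₂ L L = form M :=
    hom_ext_root fun i => hom_ext_root fun j => by
      rw [LinearMap.compl₁₂_apply, form_root_root, hv]
      simp [hL, root, Matrix.sum_apply, Matrix.vecMulVec_apply, PiLp.inner_apply, mul_comm]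
  exact congrArg (fun f => f x y) this

/-- The sum of the coordinates. -/
def height : (B →₀ ℝ) →ₗ[ℝ] ℝ := Finsupp.linearCombination ℝ fun _ => 1

@[simp] theorem height_root (i : B) : height (root i) = 1 := by simp [height, root]

theorem height_nonpos {x : B →₀ ℝ} (hx : x ≤ 0) : height x ≤ 0 := by
  rw [height, Finsupp.linearCombination_apply]
  refine Finset.sum_nonpos fun i _ => ?_
  simpa using hx i

/-- The functionals `height + form M x` form an affine subspace of the dual of the root space. It is
stable under the group, because a simple reflection changes the height by a multiple of the form
with its root; the group thus acts on it affinely. -/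
theorem exists_shift (g : M.Group) :
    ∃ v : B →₀ ℝ, ∀ z, height (rep M g⁻¹ z) = height z + form M v z := by
  induction g using group_induction_right with
  | one => exact ⟨0, by simp⟩
  | mul_simple g i ih =>
    obtain ⟨v, hv⟩ := ih
    refine ⟨v - (2 : ℝ) • rep M g (root i), fun z => ?_⟩
    rw [mul_inv_rev, simple_inv, rep_mul_apply, rep_simple, reflect_apply, map_sub, hv, map_smul,
      height_root, ← form_rep M g (rep M g⁻¹ z), rep_apply_rep_inv, map_sub, map_smul, LinearMap.sub_apply,
      LinearMap.smul_apply, form_comm M z, smul_eq_mul, smul_eq_mul]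
    ring

/-- The translation part of the affine action of the Coxeter group. -/
def shift (g : M.Group) : B →₀ ℝ := (exists_shift M g).choose

theorem height_rep_inv (g : M.Group) (z : B →₀ ℝ) :
    height (rep M g⁻¹ z) = height z + form M (shift M g) z :=
  (exists_shift M g).choose_spec z

/-- The affine action of the Coxeter group. It is an action up to the radical of the form. -/
def act (g : M.Group) (x : B →₀ ℝ) : B →₀ ℝ := rep M g x + shift M g

/-- The affine functional of a vector `z`, at the point `x`. -/
def aff (x : B →₀ ℝ) : (B →₀ ℝ) →ₗ[ℝ] ℝ := height + form M x

theorem aff_apply (x z : B →₀ ℝ) : aff M x z = height z + form M x z := rfl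

/-- Each root becomes an affine function, equivariantly. The origin is a base point at which every
simple root takes the value 1. -/
theorem aff_act (g : M.Group) (x z : B →₀ ℝ) : aff M (act M g x) (rep M g z) = aff M x z := by
  have := height_rep_inv M g (rep M g z)
  rw [rep_inv_apply_rep] at this
  rw [aff_apply, aff_apply, act, map_add, LinearMap.add_apply, form_rep, this]
  ring

theorem aff_act' (g : M.Group) (x z : B →₀ ℝ) : aff M (act M g x) z = aff M x (rep M g⁻¹ z) := by
  rw [← aff_act M g x, rep_apply_rep_inv]

variable {E : Type v} [NormedAddCommGroup E] [InnerProductSpace ℝ E]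
  {L : (B →₀ ℝ) →ₗ[ℝ] E}

/-- `L` realizes the form as a Gram matrix. -/
def IsGram (L : (B →₀ ℝ) →ₗ[ℝ] E) : Prop := ∀ x y, inner ℝ (L x) (L y) = form M x y

variable {M}

theorem IsGram.norm_sq (hL : IsGram M L) (x : B →₀ ℝ) : ‖L x‖ ^ 2 = form M x x := by
  rw [← real_inner_self_eq_norm_sq, hL]

/-- The values of `aff` determine a point modulo the radical, which L kills. The laws of an action
therefore hold after applying L. -/
theorem IsGram.eq_of_aff_eq (hL : IsGram M L) {x y : B →₀ ℝ} (h : ∀ z, aff M x z = aff M y z) :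
    L x = L y := by
  rw [← sub_eq_zero, ← map_sub, ← norm_eq_zero, ← sq_eq_zero_iff, hL.norm_sq, map_sub (form M),
    LinearMap.sub_apply, sub_eq_zero]
  simpa [aff_apply] using h (x - y)

theorem IsGram.dist_act (hL : IsGram M L) (g : M.Group) (x y : B →₀ ℝ) :
    dist (L (act M g x)) (L (act M g y)) = dist (L x) (L y) := by
  rw [dist_eq_norm, dist_eq_norm, ← map_sub, ← map_sub, act, act, add_sub_add_right_eq_sub,
    ← map_sub, ← sq_eq_sq₀ (norm_nonneg _) (norm_nonneg _), hL.norm_sq, hL.norm_sq, form_rep]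

theorem IsGram.act_mul (hL : IsGram M L) (g h : M.Group) (x : B →₀ ℝ) :
    L (act M (g * h) x) = L (act M g (act M h x)) :=
  hL.eq_of_aff_eq fun z => by
    rw [aff_act', aff_act', aff_act', mul_inv_rev, rep_mul_apply]

theorem IsGram.act_one (hL : IsGram M L) (x : B →₀ ℝ) : L (act M 1 x) = L x :=
  hL.eq_of_aff_eq fun z => by rw [aff_act', inv_one, map_one, Module.End.one_apply]

/-- Some simple root is sent by g⁻¹ to a vector of non-positive height, so this root falls from 1 at
the origin to at most 0 at the image of the origin; as a unit vector, it needs distance 1 for that.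
-/
theorem IsGram.one_le_norm_shift (hL : IsGram M L) {g : M.Group} (hg : g ≠ 1) :
    1 ≤ ‖L (act M g 0)‖ := by
  obtain ⟨i, hi⟩ := M.toCoxeterSystem.exists_rightDescent_of_ne_one (inv_ne_one.2 hg)
  have h1 := height_nonpos (rep_root_nonpos M hi)
  have h2 := aff_act' M g 0 (root i)
  rw [aff_apply, aff_apply, map_zero, LinearMap.zero_apply, add_zero, height_root, ← hL] at h2
  have h3 := abs_real_inner_le_norm (L (act M g 0)) (L (root i))
  have h4 : ‖L (root i)‖ = 1 := by
    rw [← sq_eq_sq₀ (norm_nonneg _) zero_le_one, hL.norm_sq, form_root_root, formMatrix_self,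
      one_pow]
  rw [h4, mul_one] at h3
  linarith [neg_abs_le (inner ℝ (L (act M g 0)) (L (root i)))]

theorem IsGram.one_le_dist (hL : IsGram M L) {g h : M.Group} (hgh : g ≠ h) :
    1 ≤ dist (L (act M g 0)) (L (act M h 0)) := by
  have h1 := hL.one_le_norm_shift (g := h⁻¹ * g) fun h0 => hgh (inv_mul_eq_one.1 h0).symm
  rw [← hL.dist_act h⁻¹, ← hL.act_mul, ← hL.act_mul, inv_mul_cancel, hL.act_one, map_zero,
    dist_zero_right]
  exact h1

theorem IsGram.finite_dist_le [FiniteDimensional ℝ E] (hL : IsGram M L) (c : E) (r : ℝ) :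
    {g : M.Group | dist (L (act M g 0)) c ≤ r}.Finite :=
  have := FiniteDimensional.proper ℝ E
  finite_of_separated (fun _ _ h => hL.one_le_dist h) c r

/-- A point of the orbit nearest to the origin is dominant: the origin is on the positive side of
every simple wall, so reflecting a point on the negative side brings it closer. The minimum exists
because orbits are discrete. -/
theorem IsGram.exists_dominant [FiniteDimensional ℝ E] (hL : IsGram M L) (x : B →₀ ℝ) :
    ∃ g : M.Group, ∀ i, 0 ≤ aff M (act M g x) (root i) := by
  have hnorm : ∀ g, ‖L (act M g x)‖ = dist (L (act M g⁻¹ 0)) (L x) := fun g => by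
    rw [← hL.dist_act g, ← hL.act_mul, mul_inv_cancel, hL.act_one, map_zero, dist_zero_left]
  have hfin : {g : M.Group | ‖L (act M g x)‖ ≤ ‖L x‖}.Finite := by
    refine ((hL.finite_dist_le (L x) ‖L x‖).image (·⁻¹)).subset fun g hg => ⟨g⁻¹, ?_, inv_inv g⟩
    rw [Set.mem_ofPred_eq, ← hnorm]
    exact hg
  obtain ⟨g, hg, hmin⟩ := Set.exists_min_image _ (fun g => ‖L (act M g x)‖) hfin
    ⟨1, by rw [Set.mem_ofPred_eq, hL.act_one]⟩
  refine ⟨g, fun i => ?_⟩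
  by_contra hneg
  rw [not_le] at hneg
  set y := act M g x with hy
  set c := aff M y (root i) with hc
  have hstep : L (act M (M.simple i * g) x) = L (y - (2 * c) • root i) := hL.eq_of_aff_eq fun z => by
    rw [aff_act', mul_inv_rev, rep_mul_apply, ← aff_act', simple_inv, rep_simple, reflect_apply,
      map_sub, map_smul, ← hy, ← hc, aff_apply, aff_apply, map_sub, map_smul, LinearMap.sub_apply,
      LinearMap.smul_apply, form_comm M z, smul_eq_mul, smul_eq_mul]
    ring
  -- The squared norm changes by 4c, and c < 0.
  have hlt : ‖L (act M (M.simple i * g) x)‖ < ‖L (act M g x)‖ := by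
    rw [← sq_lt_sq₀ (norm_nonneg _) (norm_nonneg _), hstep, hL.norm_sq, hL.norm_sq, ← hy]
    simp only [map_sub, map_smul, LinearMap.sub_apply, LinearMap.smul_apply, smul_eq_mul,
      form_root_root, formMatrix_self, form_comm M (root i) y]
    have h1 : c = 1 + form M y (root i) := by rw [hc, aff_apply, height_root]
    have h2 : form M y (root i) = c - 1 := by linarith
    rw [h2]
    nlinarith
  exact absurd (hmin (M.simple i * g) (hlt.le.trans hg)) (not_le.2 hlt)

/-- The roots of the Coxeter system. -/
def roots (M : CoxeterMatrix B) : Set (B →₀ ℝ) := {b | ∃ g i, b = rep M g (root i)}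

theorem form_self_of_mem_roots {b : B →₀ ℝ} (hb : b ∈ roots M) : form M b b = 1 := by
  obtain ⟨g, i, rfl⟩ := hb
  rw [form_rep, form_root_root, formMatrix_self]

theorem rep_mem_roots {b : B →₀ ℝ} (hb : b ∈ roots M) (g : M.Group) : rep M g b ∈ roots M := by
  obtain ⟨h, i, rfl⟩ := hb
  exact ⟨g * h, i, (rep_mul_apply M _ _ _).symm⟩

theorem reflect_injOn {b c : B →₀ ℝ} (hb : form M b b = 1) (hc : form M c c = 1)
    (h : reflect M b = reflect M c) : b = c ∨ b = -c := by
  have h1 := congrArg (fun f => f b) h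
  simp only [reflect_apply, hb] at h1
  have h2 : b = form M b c • c := by
    have : (2 : ℝ) • b = (2 : ℝ) • (form M b c • c) := by
      rw [smul_smul]
      have h3 := sub_right_injective h1
      rw [mul_one] at h3
      exact h3
    exact smul_right_injective _ two_ne_zero this
  have h3 : form M b c * form M b c = 1 := by
    have h4 := hb
    rw [h2] at h4
    simpa [hc] using h4
  rcases mul_self_eq_one_iff.1 h3 with h4 | h4
  · left; rwa [h4, one_smul] at h2
  · right; rwa [h4, neg_one_smul] at h2

/-- The reflection in a root vanishing at x fixes x modulo the radical. By discreteness the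
stabiliser is finite, and a reflection determines its root up to sign. -/
theorem IsGram.finite_roots_aff_eq_zero [FiniteDimensional ℝ E] (hL : IsGram M L)
    (x : B →₀ ℝ) : {b ∈ roots M | aff M x b = 0}.Finite := by
  have hstab : {g : M.Group | L (act M g x) = L x}.Finite := by
    refine (hL.finite_dist_le (L x) (dist 0 (L x))).subset fun g hg => ?_
    have h1 := hL.dist_act g 0 x
    rw [Set.mem_ofPred_eq] at hg ⊢
    rw [hg, map_zero] at h1
    exact h1.le
  have hsub : {b ∈ roots M | aff M x b = 0} ⊆ ⋃ g ∈ {g : M.Group | L (act M g x) = L x},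
      {b ∈ roots M | rep M g = reflect M b} := by
    rintro _ ⟨⟨g, i, rfl⟩, h0⟩
    rw [Set.mem_iUnion₂]
    refine ⟨g * M.simple i * g⁻¹, ?_, ⟨g, i, rfl⟩, rep_conj_simple M g i⟩
    refine hL.eq_of_aff_eq fun z => ?_
    have hinv : (g * M.simple i * g⁻¹)⁻¹ = g * M.simple i * g⁻¹ := by
      simp [mul_assoc]
    rw [aff_act', hinv, rep_conj_simple, reflect_apply, map_sub, map_smul, h0, smul_zero, sub_zero]
  refine (hstab.biUnion fun g _ => ?_).subset hsub
  rcases Set.eq_empty_or_nonempty {b ∈ roots M | rep M g = reflect M b} with h | ⟨c, hc, hgc⟩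
  · rw [h]; exact Set.finite_empty
  · refine (Set.toFinite {c, -c}).subset ?_
    rintro b ⟨hb, hgb⟩
    exact reflect_injOn (form_self_of_mem_roots hb) (form_self_of_mem_roots hc)
      (hgb.symm.trans hgc)

/-- Up to sign a root is a non-negative combination of simple roots, so it vanishes at a dominant
point only if all simple roots in its support do. -/
theorem aff_eq_zero_of_dominant {x y b : B →₀ ℝ} (hb : b ∈ roots M)
    (hx : ∀ i, 0 ≤ aff M x (root i))
    (hxy : ∀ i, aff M x (root i) = 0 → aff M y (root i) = 0) (h0 : aff M x b = 0) :
    aff M y b = 0 := by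
  have hpos : ∀ c : B →₀ ℝ, 0 ≤ c → aff M x c = 0 → aff M y c = 0 := by
    intro c hc h0
    have hsum : ∀ z, aff M z c = ∑ i ∈ c.support, c i * aff M z (root i) := fun z => by
      conv_lhs => rw [← Finsupp.sum_single c]
      rw [Finsupp.sum, map_sum]
      refine Finset.sum_congr rfl fun i _ => ?_
      rw [show Finsupp.single i (c i) = c i • root i by simp [root], map_smul, smul_eq_mul]
    rw [hsum] at h0 ⊢
    have h1 := (Finset.sum_eq_zero_iff_of_nonneg fun i _ => mul_nonneg (hc i) (hx i)).1 h0
    refine Finset.sum_eq_zero fun i hi => ?_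
    rcases mul_eq_zero.1 (h1 i hi) with h2 | h2
    · rw [h2, zero_mul]
    · rw [hxy i h2, mul_zero]
  obtain ⟨g, i, rfl⟩ := hb
  rcases rep_root_nonneg_or_nonpos M g i with h | h
  · exact hpos _ h h0
  · have := hpos (-rep M g (root i)) (neg_nonneg.2 h) (by rw [map_neg, h0, neg_zero])
    rwa [map_neg, neg_eq_zero] at this

/-- Which roots vanish at a dominant point depends only on which simple roots do. This leaves
finitely many cases, each settled at one point. -/
theorem IsGram.finite_roots_dominant [Finite B] [FiniteDimensional ℝ E] (hL : IsGram M L) :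
    {b ∈ roots M | ∃ x, (∀ i, 0 ≤ aff M x (root i)) ∧ aff M x b = 0}.Finite := by
  have hsub : {b ∈ roots M | ∃ x, (∀ i, 0 ≤ aff M x (root i)) ∧ aff M x b = 0} ⊆
      ⋃ J : Set B, {b ∈ roots M | ∃ x, (∀ i, 0 ≤ aff M x (root i)) ∧
        {i | aff M x (root i) = 0} = J ∧ aff M x b = 0} := by
    rintro b ⟨hb, x, hx, h0⟩
    exact Set.mem_iUnion.2 ⟨_, hb, x, hx, rfl, h0⟩
  refine (Set.finite_iUnion fun J => ?_).subset hsub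
  by_cases hJ : ∃ y, {i | aff M y (root i) = 0} = J
  · obtain ⟨y, rfl⟩ := hJ
    refine (hL.finite_roots_aff_eq_zero y).subset ?_
    rintro b ⟨hb, x, hx, hxy, h0⟩
    exact ⟨hb, aff_eq_zero_of_dominant hb hx (fun i hi => hxy.subset hi) h0⟩
  · refine Set.finite_empty.subset ?_
    rintro b ⟨-, x, -, hx, -⟩
    exact hJ ⟨x, hx⟩

/-- If ⟨b, c⟩ ≠ ±1, the walls of b and c meet at a point. Moving it to a dominant point preserves
the form and puts both roots in a fixed finite set. -/
theorem IsGram.finite_form_roots [Finite B] [FiniteDimensional ℝ E] (hL : IsGram M L) :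
    {r : ℝ | ∃ b ∈ roots M, ∃ c ∈ roots M, r = form M b c}.Finite := by
  have hfin := hL.finite_roots_dominant
  refine ((Set.toFinite {1, -1}).union ((hfin.prod hfin).image
    fun p => form M p.1 p.2)).subset ?_
  rintro _ ⟨b, hb, c, hc, rfl⟩
  by_cases h1 : form M b c * form M b c = 1
  · exact Or.inl (mul_self_eq_one_iff.1 h1)
  right
  have hbb := form_self_of_mem_roots hb
  have hcc := form_self_of_mem_roots hc
  set r := form M b c with hr
  have hr' : form M c b = r := form_comm M c b
  have hne : 1 - r * r ≠ 0 := sub_ne_zero.2 (Ne.symm h1)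
  -- Cramer's rule for a common zero p·b + q·c of the two affine functions; 1 − r² is the
  -- determinant.
  obtain ⟨p, hp⟩ : ∃ p, p * (1 - r * r) = -height b + r * height c := ⟨_, div_mul_cancel₀ _ hne⟩
  obtain ⟨q, hq⟩ : ∃ q, q * (1 - r * r) = -height c + r * height b := ⟨_, div_mul_cancel₀ _ hne⟩
  let x : B →₀ ℝ := p • b + q • c
  have hxb : aff M x b = 0 := by
    simp only [aff_apply, x, map_add, map_smul, LinearMap.add_apply, LinearMap.smul_apply,
      smul_eq_mul, hbb, hr']
    apply mul_right_cancel₀ hne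
    linear_combination hp + r * hq
  have hxc : aff M x c = 0 := by
    simp only [aff_apply, x, map_add, map_smul, LinearMap.add_apply, LinearMap.smul_apply,
      smul_eq_mul, hcc, ← hr]
    apply mul_right_cancel₀ hne
    linear_combination hq + r * hp
  obtain ⟨g, hg⟩ := hL.exists_dominant x
  refine ⟨(rep M g b, rep M g c), ⟨⟨rep_mem_roots hb g, _, hg, ?_⟩,
    ⟨rep_mem_roots hc g, _, hg, ?_⟩⟩, form_rep M g b c⟩
  · rw [aff_act, hxb]
  · rw [aff_act, hxc]

/-! ### The abelian subgroup of translations -/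

theorem rep_apply_of_form_eq_zero {x : B →₀ ℝ} (hx : ∀ y, form M x y = 0) (g : M.Group) :
    rep M g x = x := by
  induction g using group_induction_right with
  | one => simp
  | mul_simple g i ih =>
    rw [rep_mul_apply, rep_simple, reflect_apply, hx, mul_zero, zero_smul, sub_zero, ih]

variable (M) in
/-- The elements that act trivially modulo the radical of the form. -/
def translations : Subgroup M.Group where
  carrier := {g | ∀ x y, form M (rep M g x - x) y = 0}
  one_mem' := by simp
  mul_mem' := by
    intro g h hg hh x y
    have h1 : rep M (g * h) x - x = (rep M g (rep M h x) - rep M h x) + (rep M h x - x) := by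
      rw [rep_mul_apply]; abel
    rw [h1, map_add, LinearMap.add_apply, hg, hh, add_zero]
  inv_mem' := by
    intro g hg x y
    have h1 := hg (rep M g⁻¹ x) y
    rw [rep_apply_rep_inv] at h1
    rw [← neg_sub, map_neg, LinearMap.neg_apply, h1, neg_zero]

/-- Modulo translations, g is determined by the numbers ⟨g αᵢ, αⱼ⟩, which take finitely many values.
-/
theorem IsGram.finiteIndex_translations [Finite B] [FiniteDimensional ℝ E] (hL : IsGram M L) :
    (translations M).FiniteIndex := by
  have hfin := hL.finite_form_roots.to_subtype
  let F : M.Group → B × B → {r : ℝ | ∃ b ∈ roots M, ∃ c ∈ roots M, r = form M b c} := fun g p =>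
    ⟨form M (rep M g (root p.1)) (root p.2), _, ⟨g, p.1, rfl⟩, _, ⟨1, p.2, by simp⟩, rfl⟩
  have hF : ∀ g h, F g = F h → g⁻¹ * h ∈ translations M := by
    intro g h hgh
    have h1 : (form M).compl₁₂ (rep M g) LinearMap.id = (form M).compl₁₂ (rep M h) LinearMap.id :=
      hom_ext_root fun i => hom_ext_root fun j => congrArg Subtype.val (congrFun hgh (i, j))
    intro x y
    have h2 : form M (rep M g x) (rep M g y) = form M (rep M h x) (rep M g y) :=
      congrArg (fun f => f x (rep M g y)) h1
    rw [← form_rep M g, map_sub, rep_mul_apply, rep_apply_rep_inv, map_sub, LinearMap.sub_apply,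
      h2, sub_self]
  have : Finite (M.Group ⧸ translations M) := by
    refine Finite.of_injective (fun q : M.Group ⧸ translations M => F q.out) fun q r hqr => ?_
    have h1 := QuotientGroup.eq.2 (hF _ _ hqr)
    rwa [QuotientGroup.out_eq', QuotientGroup.out_eq'] at h1
  exact Subgroup.finiteIndex_of_finite_quotient

theorem rep_sub_comm_of_mem {g h : M.Group} (hh : h ∈ translations M) (x : B →₀ ℝ) :
    rep M g (rep M h x) = rep M g x + (rep M h x - x) := by
  conv_lhs => rw [← sub_add_cancel (rep M h x) x, map_add,
    rep_apply_of_form_eq_zero (hh x) g, add_comm]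

/-- A translation adds to x a vector of the radical, and the whole group fixes the radical. -/
theorem mul_comm_of_mem_translations {g h : M.Group} (hg : g ∈ translations M)
    (hh : h ∈ translations M) : g * h = h * g :=
  rep_ext M fun i => by
    rw [rep_mul_apply, rep_mul_apply, rep_sub_comm_of_mem hh, rep_sub_comm_of_mem hg]
    abel

theorem rep_pow_of_mem_translations {g : M.Group} (hg : g ∈ translations M) (n : ℕ)
    (x : B →₀ ℝ) : rep M (g ^ n) x = x + (n : ℝ) • (rep M g x - x) := by
  induction n with
  | zero => simp
  | succ n ih =>
    rw [pow_succ, rep_mul_apply, rep_sub_comm_of_mem hg, ih]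
    push_cast
    module

theorem rep_zpow_of_mem_translations {g : M.Group} (hg : g ∈ translations M) (n : ℤ)
    (x : B →₀ ℝ) : rep M (g ^ n) x = x + (n : ℝ) • (rep M g x - x) := by
  obtain ⟨n, rfl | rfl⟩ := n.eq_nat_or_neg
  · rw [zpow_natCast, rep_pow_of_mem_translations hg]; simp
  · have h1 := rep_sub_comm_of_mem (g := (g ^ n)⁻¹) (pow_mem hg n) x
    rw [rep_inv_apply_rep, rep_pow_of_mem_translations hg] at h1
    rw [zpow_neg, zpow_natCast]
    push_cast
    have h2 := eq_sub_of_add_eq h1.symm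
    rw [h2]
    module

theorem eq_one_of_pow_eq_one_of_mem_translations {g : M.Group} (hg : g ∈ translations M) {n : ℕ}
    (hn : n ≠ 0) (h : g ^ n = 1) : g = 1 :=
  rep_ext M fun i => by
    have h1 := rep_pow_of_mem_translations hg n (root i)
    rw [h, map_one, Module.End.one_apply, left_eq_add, smul_eq_zero] at h1
    rw [map_one, Module.End.one_apply, ← sub_eq_zero]
    exact h1.resolve_left (by exact_mod_cast hn)

end Affine

/-! ### Irreducible affine Coxeter groups -/

theorem GenSet.nonempty_of_fg (G : Type u) [Group G] [Group.FG G] : Nonempty (GenSet G) := by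
  obtain ⟨S, hS⟩ := Group.fg_def.1 ‹Group.FG G›
  exact ⟨⟨S, hS⟩⟩

theorem exists_mulEquiv_int_pow (A : Type u) [CommGroup A] [Group.FG A] [IsMulTorsionFree A] :
    ∃ n : ℕ, Nonempty (A ≃* Multiplicative (Fin n → ℤ)) := by
  have : Module.Finite ℤ (Additive A) := Module.Finite.iff_addGroup_fg.2 inferInstance
  exact ⟨_, ⟨AddEquiv.toMultiplicativeRight (Module.finBasis ℤ (Additive A)).equivFun.toAddEquiv⟩⟩

theorem isWide_int_pow (n : ℕ) : IsWide (Multiplicative (Fin (n + 2) → ℤ)) := by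
  have : Infinite (Multiplicative ℤ) := Multiplicative.ofAdd.infinite_iff.1 inferInstance
  have : Infinite (Multiplicative (Fin (n + 1) → ℤ)) :=
    Multiplicative.ofAdd.infinite_iff.1 inferInstance
  have : Group.FG (Multiplicative ℤ) := inferInstance
  have : AddGroup.FG (Fin (n + 1) → ℤ) := Module.Finite.iff_addGroup_fg.1 inferInstance
  obtain ⟨S⟩ := GenSet.nonempty_of_fg (Multiplicative ℤ)
  obtain ⟨T⟩ := GenSet.nonempty_of_fg (Multiplicative (Fin (n + 1) → ℤ))
  refine (isWide_prod S T).of_mulEquiv ?_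
  exact
    { toFun := fun p => Multiplicative.ofAdd (Fin.cons p.1.toAdd p.2.toAdd)
      invFun := fun f => (Multiplicative.ofAdd (f.toAdd 0), Multiplicative.ofAdd (Fin.tail f.toAdd))
      left_inv := fun p => by simp
      right_inv := fun f => by simp
      map_mul' := fun p q => by
        rw [← ofAdd_add]
        congr 1
        ext i
        refine Fin.cases ?_ (fun i => ?_) i <;> simp }

section

variable {B : Type u} {M : CoxeterMatrix B}

theorem conj_simple_mem_translations {g : M.Group} (hg : g ∈ translations M) (i : B) :
    M.simple i * g * M.simple i ∈ translations M := by
  intro x y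
  have h := hg (rep M (M.simple i) x) (rep M (M.simple i) y)
  rw [← form_rep M (M.simple i), map_sub, ← rep_mul_apply, ← rep_mul_apply, ← rep_mul_apply,
    ← rep_mul_apply, simple_mul_self, map_one, Module.End.one_apply, Module.End.one_apply] at h
  exact h

/-- A cyclic translation group would force all distinct simple roots to pair to −1 and to have
opposite non-zero displacements under g, which is impossible for three of them. -/
theorem not_translations_cyclic (hirr : IsIrreducible M) (hcard : 3 ≤ Nat.card B)
    {g : M.Group} (hg : g ∈ translations M) (hg1 : g ≠ 1)
    (hgen : ∀ h ∈ translations M, ∃ n : ℤ, h = g ^ n) : False := by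
  set D : Module.End ℝ (B →₀ ℝ) := rep M g - 1 with hD
  have hDx : ∀ x, D x = rep M g x - x := fun x => rfl
  -- Conjugation by sᵢ preserves the translations, so it takes g to a power gᵉ; as sᵢ fixes the
  -- radical, D ∘ sᵢ = e·D.
  have hrefl : ∀ i, ∃ e : ℝ, ∀ x, D x - (2 * form M x (root i)) • D (root i) = e • D x := by
    intro i
    obtain ⟨n, hn⟩ := hgen _ (conj_simple_mem_translations hg i)
    refine ⟨n, fun x => ?_⟩
    have h1 : rep M (M.simple i * g * M.simple i) x = x + D (rep M (M.simple i) x) := by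
      rw [rep_mul_apply, rep_mul_apply, rep_sub_comm_of_mem hg,
        ← rep_mul_apply M (M.simple i) (M.simple i), simple_mul_self, map_one, Module.End.one_apply, hDx]
    have h2 : rep M (M.simple i * g * M.simple i) x = x + (n : ℝ) • D x := by
      rw [hn, rep_zpow_of_mem_translations hg, hDx]
    have h3 := add_left_cancel (h1.symm.trans h2)
    rw [rep_simple, reflect_apply, map_sub, map_smul] at h3
    exact h3
  have hform : ∀ i, D (root i) ≠ 0 → ∀ x, D x = form M x (root i) • D (root i) := by
    intro i hi x
    obtain ⟨e, he⟩ := hrefl i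
    have h1 := he (root i)
    rw [form_root_root, formMatrix_self, ← sub_eq_zero] at h1
    have h2 : (-1 - e) • D (root i) = 0 := by rw [← h1]; module
    have h3 : e = -1 := by
      have := (smul_eq_zero.1 h2).resolve_right hi
      linarith
    have h4 := he x
    rw [h3, ← sub_eq_zero] at h4
    have h5 : (2 : ℝ) • (D x - form M x (root i) • D (root i)) = 0 := by rw [← h4]; module
    exact sub_eq_zero.1 ((smul_eq_zero.1 h5).resolve_left two_ne_zero)
  obtain ⟨i₀, hi₀⟩ : ∃ i, D (root i) ≠ 0 := by
    by_contra hcon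
    push Not at hcon
    refine hg1 (rep_ext M fun i => ?_)
    rw [map_one, Module.End.one_apply]
    exact sub_eq_zero.1 (hcon i)
  -- Otherwise the simple roots killed by D would be orthogonal to the others, splitting the system.
  have hall : ∀ i, D (root i) ≠ 0 := by
    by_contra hcon
    push Not at hcon
    obtain ⟨j₀, hj₀⟩ := hcon
    refine hirr ⟨{i | D (root i) ≠ 0}, {i | D (root i) ≠ 0}ᶜ, ⟨i₀, hi₀⟩, ⟨j₀, fun h => h hj₀⟩,
      disjoint_compl_right, Set.union_compl_self _, fun i hi j hj => ?_⟩
    have hj' : D (root j) = 0 := not_not.1 hj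
    have h1 := hform i hi (root j)
    rw [hj', form_root_root] at h1
    rw [← formMatrix_eq_zero_iff, formMatrix_comm]
    exact (smul_eq_zero.1 h1.symm).resolve_right hi
  have hneg : ∀ i j, i ≠ j → D (root j) = -D (root i) := by
    intro i j hij
    have h1 := hform i (hall i) (root j)
    have h2 := hform j (hall j) (root i)
    rw [form_root_root] at h1 h2
    rw [formMatrix_comm] at h2
    have h3 : (1 - formMatrix M j i * formMatrix M j i) • D (root j) = 0 := by
      rw [sub_smul, one_smul, mul_smul, ← h2, ← h1, sub_self]
    have h4 := (smul_eq_zero.1 h3).resolve_right (hall j)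
    have h5 : formMatrix M j i = -1 := by
      have h6 := formMatrix_nonpos M hij.symm
      rcases mul_self_eq_one_iff.1 (sub_eq_zero.1 h4).symm with h7 | h7
      · linarith
      · exact h7
    rw [h1, h5, neg_one_smul]
  have : Finite B := Nat.finite_of_card_ne_zero (by omega)
  have := Fintype.ofFinite B
  obtain ⟨i, j, k, hij, hik, hjk⟩ := Fintype.two_lt_card_iff.1 (by
    rw [← Nat.card_eq_fintype_card]; omega : 2 < Fintype.card B)
  have h1 := hneg i j hij
  have h2 := hneg i k hik
  have h3 := hneg j k hjk
  rw [h1, h2] at h3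
  have h4 : (2 : ℝ) • D (root i) = 0 := by
    rw [two_smul]
    rw [neg_neg] at h3
    rw [← sub_eq_zero] at h3
    have : D (root i) + D (root i) = -(-D (root i) - D (root i)) := by abel
    rw [this, h3, neg_zero]
  exact hall i ((smul_eq_zero.1 h4).resolve_left two_ne_zero)

/-- The translations are ℤⁿ: n = 0 would make W finite, n = 1 is excluded by the preceding result,
and n ≥ 2 gives a wide subgroup of finite index. -/
theorem thickOfOrderAtMost_one_of_affine (h : IsIrreducibleAffine M) (hcard : 3 ≤ Nat.card B) :
    ThickOfOrderAtMost 1 M.Group := by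
  obtain ⟨hirr, hsph, hpsd⟩ := h
  have : Finite B := Nat.finite_of_card_ne_zero (by omega)
  obtain ⟨m, L, hL⟩ := exists_gram M hpsd
  have hfi : (translations M).FiniteIndex := IsGram.finiteIndex_translations hL
  have hfg : Group.FG M.Group :=
    Group.fg_def.2 ⟨(simpleGenSet M).carrier, (simpleGenSet M).closure_eq⟩
  let inst : CommGroup (translations M) :=
    { (inferInstance : Group (translations M)) with
      mul_comm := fun g h => Subtype.ext (mul_comm_of_mem_translations g.2 h.2) }
  have htf : IsMulTorsionFree (translations M) := by
    refine ⟨fun n hn g h hgh => ?_⟩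
    have h1 : (g * h⁻¹) ^ n = 1 := by
      dsimp only at hgh
      rw [mul_pow, hgh, ← mul_pow, mul_inv_cancel, one_pow]
    rw [← mul_inv_eq_one]
    exact Subtype.ext (eq_one_of_pow_eq_one_of_mem_translations (g * h⁻¹).2 hn
      (congrArg Subtype.val h1))
  have hfg' : Group.FG (translations M) := Subgroup.fg_of_index_ne_zero _
  obtain ⟨n, ⟨e⟩⟩ := exists_mulEquiv_int_pow (translations M)
  rcases n with _ | _ | n
  · have : Finite (translations M) := e.toEquiv.finite_iff.2 inferInstance
    exact absurd (Finite.of_subgroup_quotient (translations M)) hsph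
  · exfalso
    let a : Multiplicative (Fin 1 → ℤ) := Multiplicative.ofAdd fun _ => 1
    refine not_translations_cyclic hirr hcard (e.symm a).2 (fun h1 => ?_) fun h hh => ?_
    · have h2 : e.symm a = 1 := Subtype.ext h1
      rw [EmbeddingLike.map_eq_one_iff] at h2
      have := congrFun (congrArg Multiplicative.toAdd h2) 0
      exact one_ne_zero this
    · refine ⟨(e ⟨h, hh⟩).toAdd 0, ?_⟩
      have h1 : e ⟨h, hh⟩ = a ^ ((e ⟨h, hh⟩).toAdd 0) := by
        apply Multiplicative.toAdd.injective
        ext i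
        rw [toAdd_zpow, Subsingleton.elim (α := Fin 1) i 0]
        simp [a]
      have h2 : (⟨h, hh⟩ : translations M) = (e.symm a) ^ ((e ⟨h, hh⟩).toAdd 0) := by
        rw [← map_zpow, ← h1, e.symm_apply_apply]
      exact congrArg Subtype.val h2
  · have hw : ThickOfOrderAtMost 0 (translations M) := (isWide_int_pow n).of_mulEquiv e.symm
    exact .of_finiteIndex (simpleGenSet M) hw

/-! ### The classes `𝕋` and `𝒯` -/

theorem StronglyAlgThick.of_mulEquiv {G : Type u} [Group G] {H : Type v} [Group H] (f : G ≃* H)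
    (hG : StronglyAlgThick G) : StronglyAlgThick H :=
  hG.imp fun n hn => hn.of_mulEquiv n f

theorem fg_parabolic [Finite B] (M : CoxeterMatrix B) (J : Set B) : (parabolic M J).FG :=
  (Subgroup.fg_iff _).2 ⟨_, rfl, (Set.toFinite J).image _⟩

/-- A common generator commutes with all of J, so either it splits off from J or it is all of J and
W_J has at most two elements. -/
theorem disjoint_of_commutator_eq_bot {J K : Set B} (hJ : IsIrreducible (restrict M J))
    (hJ' : ¬ IsSpherical (restrict M J)) (h : ⁅parabolic M J, parabolic M K⁆ = ⊥) :
    J ∩ K = ∅ := by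
  rw [Set.eq_empty_iff_forall_notMem]
  rintro s ⟨hsJ, hsK⟩
  have hcomm : ∀ t ∈ J, t ≠ s → M t s = 2 := fun t ht hts => by
    refine eq_two_of_commute M hts ?_
    have h1 := Subgroup.commutator_mem_commutator (simple_mem_parabolic M ht)
      (simple_mem_parabolic M hsK)
    rw [h, Subgroup.mem_bot, commutatorElement_eq_one_iff_commute] at h1
    exact h1
  by_cases hs : ∃ t ∈ J, t ≠ s
  · obtain ⟨t, htJ, hts⟩ := hs
    refine hJ ⟨{⟨s, hsJ⟩}ᶜ, {⟨s, hsJ⟩}, ⟨⟨t, htJ⟩, fun h => hts (congrArg Subtype.val h)⟩,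
      Set.singleton_nonempty _, disjoint_compl_left, Set.compl_union_self _, ?_⟩
    rintro ⟨i, hi⟩ his j rfl
    exact hcomm i hi fun h => his (Subtype.ext h)
  · push Not at hs
    apply hJ'
    have hJs : ∀ g : (restrict M J).Group, g = 1 ∨ g = (restrict M J).simple ⟨s, hsJ⟩ := by
      intro g
      induction g using group_induction_right with
      | one => exact Or.inl rfl
      | mul_simple g i ih =>
        have hi : i = ⟨s, hsJ⟩ := Subtype.ext (hs i i.2)
        rw [hi]
        rcases ih with rfl | rfl
        · exact Or.inr (one_mul _)
        · exact Or.inl (simple_mul_self _ _)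
    exact Set.finite_univ_iff.1 ((Set.toFinite {1, (restrict M J).simple ⟨s, hsJ⟩}).subset
      fun g _ => hJs g)

/-- W is the direct product W_J × W_K: the factors commute, generate W, and meet in the parabolic
subgroup of the empty set. -/
theorem isWide_of_commuting_parabolics [Finite B] {J K : Set B} (hJK : J ∪ K = Set.univ)
    (hdisj : J ∩ K = ∅) (hJ : ¬ IsSpherical (restrict M J)) (hK : ¬ IsSpherical (restrict M K))
    (h : ⁅parabolic M J, parabolic M K⁆ = ⊥) : IsWide M.Group := by
  have hcomm : ∀ (g : parabolic M J) (h : parabolic M K), Commute (g : M.Group) h := by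
    intro g k
    have h1 := Subgroup.commutator_mem_commutator g.2 k.2
    rwa [h, Subgroup.mem_bot, commutatorElement_eq_one_iff_commute] at h1
  let f : parabolic M J × parabolic M K →* M.Group :=
    MonoidHom.noncommCoprod (parabolic M J).subtype (parabolic M K).subtype hcomm
  have hf : ∀ p, f p = p.1 * p.2 := fun p => rfl
  have hinj : Function.Injective f := by
    rw [injective_iff_map_eq_one]
    rintro ⟨g, k⟩ hgk
    rw [hf] at hgk
    have h1 : (g : M.Group) = (k : M.Group)⁻¹ := eq_inv_of_mul_eq_one_left hgk
    have h2 : (g : M.Group) ∈ parabolic M J ⊓ parabolic M K :=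
      Subgroup.mem_inf.2 ⟨g.2, by rw [h1]; exact inv_mem k.2⟩
    rw [parabolic_inf, hdisj, parabolic, Set.image_empty, Subgroup.closure_empty,
      Subgroup.mem_bot] at h2
    rw [h2, eq_comm, inv_eq_one] at h1
    exact Prod.ext (Subtype.ext h2) (Subtype.ext h1)
  have hsurj : Function.Surjective f := by
    rw [← MonoidHom.range_eq_top, eq_top_iff, ← parabolic_univ, ← hJK, ← parabolic_sup, sup_le_iff]
    exact ⟨fun g hg => ⟨(⟨g, hg⟩, 1), by simp [hf]⟩, fun g hg => ⟨(1, ⟨g, hg⟩), by simp [hf]⟩⟩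
  have := infinite_parabolic M hJ
  have := infinite_parabolic M hK
  have := (Group.fg_iff_subgroup_fg _).2 (fg_parabolic M J)
  have := (Group.fg_iff_subgroup_fg _).2 (fg_parabolic M K)
  obtain ⟨S⟩ := GenSet.nonempty_of_fg (parabolic M J)
  obtain ⟨T⟩ := GenSet.nonempty_of_fg (parabolic M K)
  exact (isWide_prod S T).of_mulEquiv (MulEquiv.ofBijective f ⟨hinj, hsurj⟩)

theorem ThickOfOrderAtMost.adjoin [Finite B] {n : ℕ} (s : B)
    (hs : ¬ IsSpherical (restrict M (perp M s)))
    (h : ThickOfOrderAtMost n (parabolic M {s}ᶜ)) : ThickOfOrderAtMost (n + 1) M.Group := by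
  set P := parabolic M {s}ᶜ with hP
  set Q := P.map (MulAut.conj (M.simple s)).toMonoidHom with hQ
  have hmap : ∀ g ∈ P ⊔ Q, M.simple s * g * M.simple s ∈ P ⊔ Q := by
    have hinvol : (MulAut.conj (M.simple s)).toMonoidHom.comp
        (MulAut.conj (M.simple s)).toMonoidHom = MonoidHom.id M.Group := by
      ext g; simp [mul_assoc]
    have hle : (P ⊔ Q).map (MulAut.conj (M.simple s)).toMonoidHom ≤ P ⊔ Q := by
      rw [Subgroup.map_sup, ← hQ, hQ, Subgroup.map_map, hinvol, Subgroup.map_id, sup_comm]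
    intro g hg
    have := hle ⟨g, hg, rfl⟩
    simpa using this
  -- P ⊔ Q is normalised by s and contains all other generators, so its only right cosets are itself
  -- and its translate by s.
  have hcover : ∀ g : M.Group, g ∈ P ⊔ Q ∨ g * M.simple s ∈ P ⊔ Q := by
    intro g
    induction g using group_induction_right with
    | one => exact Or.inl (one_mem _)
    | mul_simple g i ih =>
      by_cases hi : i = s
      · subst hi
        rcases ih with ih | ih
        · exact Or.inr (by rwa [mul_assoc, simple_mul_self, mul_one])
        · exact Or.inl ih
      · have hiP : M.simple i ∈ P ⊔ Q := Subgroup.mem_sup_left (simple_mem_parabolic M hi)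
        rcases ih with ih | ih
        · exact Or.inl (mul_mem ih hiP)
        · refine Or.inr ?_
          have := mul_mem ih (hmap _ hiP)
          simpa [mul_assoc] using this
  have hfi : (P ⊔ Q).FiniteIndex := by
    have : Finite (M.Group ⧸ (P ⊔ Q)) := by
      refine Set.finite_univ_iff.1 ((Set.toFinite {((1 : M.Group) : M.Group ⧸ (P ⊔ Q)),
        ((M.simple s : M.Group) : M.Group ⧸ (P ⊔ Q))}).subset fun q _ => ?_)
      obtain ⟨g, rfl⟩ := QuotientGroup.mk_surjective q
      rcases hcover g⁻¹ with h1 | h1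
      · left
        rw [QuotientGroup.eq]
        simpa using h1
      · right
        refine QuotientGroup.eq.2 ?_
        exact h1
    exact Subgroup.finiteIndex_of_finite_quotient
  refine .of_pair (simpleGenSet M) h (h.of_mulEquiv _
    ((MulAut.conj (M.simple s)).subgroupMap P)) hfi (Or.inr ?_) (isQuasiconvex_parabolic M _)
    ((isQuasiconvex_parabolic M _).map_conj _)
  change Infinite ↥(P ⊓ Q) ∧ (P ⊓ Q).FG
  rw [hQ, hP, parabolic_inf_conj]
  exact ⟨infinite_parabolic M hs, fg_parabolic M _⟩

theorem ThickOfOrderAtMost.union [Finite B] {n : ℕ} {J K : Set B} (hJK : J ∪ K = Set.univ)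
    (hinf : ¬ IsSpherical (restrict M (J ∩ K))) (hJ : ThickOfOrderAtMost n (parabolic M J))
    (hK : ThickOfOrderAtMost n (parabolic M K)) : ThickOfOrderAtMost (n + 1) M.Group := by
  refine .of_pair (simpleGenSet M) hJ hK ?_ (Or.inr ?_) (isQuasiconvex_parabolic M J)
    (isQuasiconvex_parabolic M K)
  · rw [parabolic_sup, hJK, parabolic_univ]
    infer_instance
  · rw [parabolic_inf]
    exact ⟨infinite_parabolic M hinf, fg_parabolic M _⟩

end

/-- Finiteness of the index type is assumed inside the claim, since the type changes along the
induction. -/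
theorem ClassT.stronglyAlgThick {B : Type u} {M : CoxeterMatrix B} (h : ClassT M) :
    ∀ [Finite B], StronglyAlgThick M.Group := by
  induction h with
  | affine M h hcard => exact ⟨1, thickOfOrderAtMost_one_of_affine h hcard⟩
  | product M J K hJK hJ hJ' hK hK' h =>
    exact ⟨0, isWide_of_commuting_parabolics hJK
      (disjoint_of_commutator_eq_bot hJ hJ' h) hJ' hK' h⟩
  | adjoin M s hs _ ih =>
    intro _
    obtain ⟨n, hn⟩ := ih.of_mulEquiv (parabolicEquiv M {s}ᶜ)
    exact ⟨n + 1, hn.adjoin s hs⟩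
  | union M J K hJK _ _ hinf ihJ ihK =>
    intro _
    obtain ⟨m, hm⟩ := ihJ.of_mulEquiv (parabolicEquiv M J)
    obtain ⟨n, hn⟩ := ihK.of_mulEquiv (parabolicEquiv M K)
    exact ⟨max m n + 1, .union hJK hinf (hm.mono (le_max_left m n)) (hn.mono (le_max_right m n))⟩

/-! ### Right-angled Coxeter groups -/

section RightAngled

variable {V : Type u} (Γ : SimpleGraph V)

theorem racMatrix_of_adj {i j : V} (h : Γ.Adj i j) : racMatrix Γ i j = 2 :=
  (if_neg h.ne).trans (if_pos h)

theorem racMatrix_of_not_adj {i j : V} (hij : i ≠ j) (h : ¬ Γ.Adj i j) : racMatrix Γ i j = 0 :=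
  (if_neg hij).trans (if_neg h)

theorem racMatrix_eq_two_iff {i j : V} : racMatrix Γ i j = 2 ↔ Γ.Adj i j := by
  refine ⟨fun h => ?_, racMatrix_of_adj Γ⟩
  by_contra hadj
  by_cases hij : i = j
  · subst hij; rw [(racMatrix Γ).diagonal] at h; omega
  · rw [racMatrix_of_not_adj Γ hij hadj] at h; omega

theorem restrict_racMatrix (J : Set V) : restrict (racMatrix Γ) J = racMatrix (Γ.induce J) := by
  ext i j
  change racMatrix Γ i j = racMatrix (Γ.induce J) i j
  by_cases hij : i = j
  · subst hij; rw [(racMatrix Γ).diagonal, (racMatrix (Γ.induce J)).diagonal]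
  by_cases h : Γ.Adj i j
  · rw [racMatrix_of_adj Γ h, racMatrix_of_adj (Γ.induce J) h]
  · rw [racMatrix_of_not_adj Γ (fun h => hij (Subtype.ext h)) h,
      racMatrix_of_not_adj (Γ.induce J) hij h]

theorem perp_racMatrix (v : V) : perp (racMatrix Γ) v = Γ.neighborSet v :=
  Set.ext fun _ => racMatrix_eq_two_iff Γ

/-- Two simple reflections without relation generate an infinite group. -/
theorem not_isSpherical_of_eq_zero {B : Type u} (M : CoxeterMatrix B) {i j : B}
    (hij : M i j = 0) : ¬ IsSpherical M := by
  have hne : i ≠ j := by rintro rfl; simp at hij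
  intro hfin
  have : Finite M.Group := hfin
  obtain ⟨n, hn, hpow⟩ := isOfFinOrder_iff_pow_eq_one.1
    (isOfFinOrder_of_finite (M.simple i * M.simple j))
  have hform : form M (root i) (root j) = -1 := by simp [formMatrix, hij]
  have hform' : form M (root j) (root i) = -1 := by rw [form_comm, hform]
  -- Both reflections fix `root i + root j`, so the product is unipotent on the plane and has
  -- infinite order.
  have hstep : ∀ k : ℕ, rep M ((M.simple i * M.simple j) ^ k) (root i) =
      root i + (2 * k : ℝ) • (root i + root j) := by
    intro k
    induction k with
    | zero => simp
    | succ k ih =>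
      rw [pow_succ', rep_mul_apply, ih, rep_mul_apply, rep_simple, rep_simple]
      simp only [reflect_apply, map_add, map_smul, map_sub, hform, hform', form_root_root,
        formMatrix_self]
      push_cast
      module
  have h := congrArg (fun x => x j) (hstep n)
  rw [hpow, map_one, Module.End.one_apply] at h
  simp only [Finsupp.add_apply, Finsupp.smul_apply, root_apply_self, root_apply_of_ne hne,
    smul_eq_mul] at h
  have : (0 : ℝ) < n := by exact_mod_cast hn
  linarith

theorem not_isSpherical_of_not_isClique {J : Set V} (h : ¬ Γ.IsClique J) :
    ¬ IsSpherical (restrict (racMatrix Γ) J) := by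
  rw [SimpleGraph.isClique_iff, Set.Pairwise] at h
  push Not at h
  obtain ⟨i, hi, j, hj, hij, hadj⟩ := h
  exact not_isSpherical_of_eq_zero (restrict (racMatrix Γ) J) (i := ⟨i, hi⟩) (j := ⟨j, hj⟩)
    (racMatrix_of_not_adj Γ hij hadj)

theorem isIrreducible_of_isIndepSet {J : Set V}
    (h : ∀ i ∈ J, ∀ j ∈ J, ¬ Γ.Adj i j) : IsIrreducible (restrict (racMatrix Γ) J) := by
  rintro ⟨J', K', ⟨i, hi⟩, ⟨j, hj⟩, -, -, h2⟩
  exact h i i.2 j j.2 ((racMatrix_eq_two_iff Γ).1 (h2 i hi j hj))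

/-- The two sides of the square are non-adjacent pairs that commute with each other, which gives a
product of two infinite dihedral groups. -/
theorem classT_of_square (e : Γ ≃g completeBipartiteGraph (Fin 2) (Fin 2)) :
    ClassT (racMatrix Γ) := by
  let J : Set V := {v | (e v).isLeft}
  let K : Set V := {v | (e v).isRight}
  have hadj : ∀ v w, Γ.Adj v w ↔
      ((e v).isLeft ∧ (e w).isRight) ∨ ((e v).isRight ∧ (e w).isLeft) := fun v w => by
    rw [← e.map_adj_iff]; rfl
  have hJ : ∀ i ∈ J, ∀ j ∈ J, ¬ Γ.Adj i j := fun i hi j hj h => by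
    rw [hadj] at h
    simp only [J, Set.mem_ofPred_eq] at hi hj
    cases hi' : e i <;> cases hj' : e j <;> simp_all
  have hK : ∀ i ∈ K, ∀ j ∈ K, ¬ Γ.Adj i j := fun i hi j hj h => by
    rw [hadj] at h
    simp only [K, Set.mem_ofPred_eq] at hi hj
    cases hi' : e i <;> cases hj' : e j <;> simp_all
  refine ClassT.product _ J K ?_ (isIrreducible_of_isIndepSet Γ hJ)
    (not_isSpherical_of_not_isClique Γ fun h => ?_) (isIrreducible_of_isIndepSet Γ hK)
    (not_isSpherical_of_not_isClique Γ fun h => ?_) ?_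
  · ext v
    cases hv : e v <;> simp [J, K, hv]
  · have h0 : e.symm (Sum.inl 0) ∈ J := by simp [J]
    have h1 : e.symm (Sum.inl 1) ∈ J := by simp [J]
    exact hJ _ h0 _ h1 (h h0 h1 (by simp))
  · have h0 : e.symm (Sum.inr 0) ∈ K := by simp [K]
    have h1 : e.symm (Sum.inr 1) ∈ K := by simp [K]
    exact hK _ h0 _ h1 (h h0 h1 (by simp))
  · rw [Subgroup.commutator_eq_bot_iff_le_centralizer, parabolic, Subgroup.closure_le]
    rintro _ ⟨i, hi, rfl⟩
    rw [SetLike.mem_coe, parabolic, Subgroup.centralizer_closure]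
    rw [Subgroup.mem_centralizer_iff]
    rintro _ ⟨j, hj, rfl⟩
    have hij : Γ.Adj i j := (hadj i j).2 (Or.inl ⟨hi, hj⟩)
    have h1 := simple_conj_of_mem_perp (racMatrix Γ) (s := i) (t := j) (racMatrix_of_adj Γ hij)
    nth_rewrite 1 [← h1]
    rw [mul_assoc, simple_mul_self, mul_one]

theorem ThickGraph.classT {V : Type u} {Γ : SimpleGraph V} (h : ThickGraph Γ) :
    ClassT (racMatrix Γ) := by
  induction h with
  | square Γ h => exact classT_of_square Γ h.some
  | cone Γ v _ hv ih =>
    refine ClassT.adjoin _ v ?_ ?_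
    · rw [perp_racMatrix]
      exact not_isSpherical_of_not_isClique Γ hv
    · rw [restrict_racMatrix]
      exact ih
  | union Γ V₁ V₂ hV _ _ hint ih₁ ih₂ =>
    refine ClassT.union _ V₁ V₂ hV ?_ ?_ (not_isSpherical_of_not_isClique Γ hint)
    · rw [restrict_racMatrix]; exact ih₁
    · rw [restrict_racMatrix]; exact ih₂

end RightAngled

end

end ThickCoxeter

theorem mainTheorem5 :
    (∀ (B : Type u) [Finite B] (M : CoxeterMatrix B) (W : Type v) [Group W],
      CoxeterSystem M W → ThickCoxeter.ClassT M → ThickCoxeter.StronglyAlgThick W) ∧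
    (∀ (V : Type w) [Finite V] (Γ : SimpleGraph V), ThickCoxeter.ThickGraph Γ →
      ThickCoxeter.StronglyAlgThick (ThickCoxeter.racMatrix Γ).Group) := by
  refine ⟨fun B _ M W _ cs h => h.stronglyAlgThick.of_mulEquiv cs.mulEquiv.symm,
    fun V _ Γ h => h.classT.stronglyAlgThick⟩
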